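/- Let $\mathfrak g=\mathfrak g_{\bar 0}\oplus\mathfrak g_{\bar 1}$ be a basic classical Lie superalgebra over $\mathbb C$ of type I: a finite-dimensional simple Lie superalgebra that admits a non-degenerate supersymmetric consistent (i.e. even) invariant bilinear form and for which $\mathfrak g_{\bar 1}$ is the direct sum of two irreducible $\mathfrak g_{\bar 0}$-modules (these are $\mathfrak{sl}(m|n)$ with $m\neq n$, $\mathfrak{psl}(n|n)$ and $\mathfrak{osp}(2|2n)$). Let $\mathfrak p=\mathfrak l+\mathfrak n$ be a parabolic subalgebra with Levi subalgebra $\mathfrak l$, with corresponding decomposition $\mathfrak g=\overline{\mathfrak n}+\mathfrak l+\mathfrak n$. Let $\mathbb W$ be a finite-dimensional irreducible $\mathfrak g$-module which is a star representation for an adjoint operation $\dagger$; that is, $\dagger:\mathfrak g\to\mathfrak g$ is antilinear and even, with $[A,B]^\dagger=[B^\dagger,A^\dagger]$ and $(A^\dagger)^\dagger=A$, and $\mathbb W$ has a positive definite hermitian inner product with $\langle Av,w\rangle=\langle v,A^\dagger w\rangle$ for $A\in\mathfrak g$, $v,w\in\mathbb W$. Let $(\cdot,\cdot)$ be a non-degenerate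 supersymmetric consistent invariant bilinear form on $\mathfrak g$ (a normalisation of the "Killing form"). Suppose that $\mathfrak n$ has a homogeneous basis $\{\xi_a\}$ with $$\xi_a^\dagger=(-1)^{|\xi_a|}\,\xi_a^\ddagger\quad\text{for all }a,$$ where $\{\xi_a^\ddagger\}$ is the dual basis of $\overline{\mathfrak n}$, $(\xi_a^\ddagger,\xi_b)=\delta_{ab}$. On $C^\bullet(\mathfrak n,\mathbb W)=\bigoplus_k\Lambda^k\overline{\mathfrak n}\otimes\mathbb W$, where $\Lambda\overline{\mathfrak n}$ is the exterior algebra in the super sense ($X\wedge Y=-(-1)^{|X||Y|}Y\wedge X$), let $A[\cdot]$ denote the operators given by $A[w]=A\cdot w$ and $A[Y\wedge f]=[A,Y]_{\overline{\mathfrak n}}\wedge f+(-1)^{|A||Y|}Y\wedge A[f]$ for homogeneous $A\in\mathfrak g$ and $Y\in\overline{\mathfrak n}$, where $[\cdot,\cdot]_{\overline{\mathfrak n}}$ is the projection of the bracket onto $\overline{\mathfrak n}$ along $\mathfrak p$. Let $\delta^*$ (boundary) and $\delta$ (coboundary) be the operators given, for $w\in\mathbb W$ and $Y\in\overline{\mathfrak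 n}$, by $$\delta^*(w)=0,\qquad \delta^*(Y\wedge f)=-Y[f]-Y\wedge\delta^*(f),$$ $$\delta(w)=\sum_a(-1)^{|\xi_a|}\xi_a^\ddagger\otimes\xi_a\cdot w,\qquad \delta(Y\wedge f)=\tfrac12\sum_a(-1)^{|\xi_a|}\xi_a^\ddagger\wedge[\xi_a,Y]_{\overline{\mathfrak n}}\wedge f-Y\wedge\delta(f).$$ Then $\delta$ and $\delta^*$ are disjoint, i.e. $\delta\delta^*f=0$ implies $\delta^*f=0$ and $\delta^*\delta f=0$ implies $\delta f=0$; and for every $k\geq 0$ the homology group $H_k(\overline{\mathfrak n},\mathbb W)=\ker\delta^*_k/\operatorname{im}\delta^*_{k+1}$ (with $\delta^*_k$ the restriction of $\delta^*$ to $\Lambda^k\overline{\mathfrak n}\otimes\mathbb W$) is a completely reducible $\mathfrak l$-module, where $\mathfrak l$ acts through the operators $A[\cdot]$. -/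

import Mathlib

noncomputable section

namespace KostantSuper

open scoped TensorProduct

set_option linter.unusedSectionVars false

/-- The Koszul sign `(-1)^{ij}`. -/
def koszul (i j : ZMod 2) : ℂ := if i = 1 ∧ j = 1 then -1 else 1

theorem zmod_two (i : ZMod 2) : i = 0 ∨ i = 1 := by revert i; decide

theorem koszul_comm (i j : ZMod 2) : koszul i j = koszul j i := by
  simp only [koszul, and_comm]

theorem koszul_sq (i j : ZMod 2) : koszul i j * koszul i j = 1 := by
  unfold koszul; split_ifs <;> norm_num

theorem koszul_add_left (i j k : ZMod 2) : koszul (i + j) k = koszul i k * koszul j k := by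
  have h : (1 + 1 : ZMod 2) = 0 := by decide
  rcases zmod_two i with rfl | rfl <;> rcases zmod_two j with rfl | rfl <;>
    rcases zmod_two k with rfl | rfl <;> simp [koszul, h]

theorem koszul_add_right (i j k : ZMod 2) : koszul k (i + j) = koszul k i * koszul k j := by
  rw [koszul_comm, koszul_add_left, koszul_comm i, koszul_comm j]

/-! ### Super vector spaces -/

/-- A complex super vector space `V = V_0 ⊕ V_1`. -/
class SuperSpace (V : Type*) [AddCommGroup V] [Module ℂ V] where
  gr : ZMod 2 → Submodule ℂ V
  isCompl : IsCompl (gr 0) (gr 1)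

open SuperSpace

section Super

variable {V : Type*} [AddCommGroup V] [Module ℂ V] [SuperSpace V]

/-- The projection onto the component of parity `i`. -/
def proj (i : ZMod 2) : V →ₗ[ℂ] V :=
  if i = 0 then (gr 0).projection (gr 1) isCompl else (gr 1).projection (gr 0) isCompl.symm

theorem proj_mem (i : ZMod 2) (x : V) : proj i x ∈ gr (V := V) i := by
  rcases zmod_two i with rfl | rfl
  · exact Submodule.projection_apply_mem _ x
  · exact Submodule.projection_apply_mem _ x

theorem proj_add (x : V) : proj 0 x + proj 1 x = x := by
  have h := LinearMap.congr_fun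
    (Submodule.projection_add_projection_eq_id (SuperSpace.isCompl (V := V))) x
  simpa [proj] using h

theorem proj_of_mem {i : ZMod 2} {x : V} (hx : x ∈ gr (V := V) i) (j : ZMod 2) :
    proj j x = if j = i then x else 0 := by
  rcases zmod_two i with rfl | rfl <;> rcases zmod_two j with rfl | rfl <;>
    simp [proj, hx, Submodule.projection_apply_of_mem_left,
      (Submodule.projection_apply_eq_zero_iff _).2]

/-- The operator `x ↦ (-1)^{a|x|} x`; for `a = 1` this is the parity involution. -/
def twist (a : ZMod 2) : V →ₗ[ℂ] V := proj 0 + koszul a 1 • proj 1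

theorem twist_of_mem (a : ZMod 2) {i : ZMod 2} {x : V} (hx : x ∈ gr (V := V) i) :
    twist a x = koszul a i • x := by
  simp only [twist, LinearMap.add_apply, LinearMap.smul_apply, proj_of_mem hx]
  rcases zmod_two i with rfl | rfl <;> simp [koszul]

/-- A subspace is graded if it contains the even and the odd part of each of its elements. -/
def IsGraded (p : Submodule ℂ V) : Prop := ∀ x ∈ p, ∀ i, proj i x ∈ p

theorem IsGraded.twist_mem {p : Submodule ℂ V} (hp : IsGraded p) (a : ZMod 2) :
    ∀ x ∈ p, twist a x ∈ p := fun x hx =>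
  p.add_mem (hp x hx 0) (p.smul_mem _ (hp x hx 1))

theorem IsGraded.sup {p q : Submodule ℂ V} (hp : IsGraded p) (hq : IsGraded q) :
    IsGraded (p ⊔ q) := by
  intro x hx i
  obtain ⟨y, hy, z, hz, rfl⟩ := Submodule.mem_sup.1 hx
  rw [map_add]
  exact Submodule.add_mem_sup (hp y hy i) (hq z hz i)

theorem IsGraded.iSup {ι : Sort*} {p : ι → Submodule ℂ V} (hp : ∀ k, IsGraded (p k)) :
    IsGraded (⨆ k, p k) := by
  intro x hx i
  have : (⨆ k, p k) ≤ (⨆ k, p k).comap (proj i) :=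
    iSup_le fun k y hy => Submodule.mem_iSup_of_mem k (hp k y hy i)
  exact this hx

end Super

/-! ### The supersymmetric exterior algebra `Λ N`, and the space `Λ N ⊗ W` -/

section Exterior

variable {V : Type*} [AddCommGroup V] [Module ℂ V] [SuperSpace V]

/-- The relations `X ∧ Y = -(-1)^{|X||Y|} Y ∧ X` for homogeneous `X`, `Y` in `N`. -/
inductive ExtRel (N : Submodule ℂ V) : TensorAlgebra ℂ N → TensorAlgebra ℂ N → Prop
  | of (i j : ZMod 2) (X Y : N) (hX : (X : V) ∈ gr (V := V) i) (hY : (Y : V) ∈ gr (V := V) j) :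
      ExtRel N (TensorAlgebra.ι ℂ X * TensorAlgebra.ι ℂ Y)
        (-koszul i j • (TensorAlgebra.ι ℂ Y * TensorAlgebra.ι ℂ X))

/-- The exterior algebra of the super vector space `N`. -/
def SuperExt (N : Submodule ℂ V) : Type _ := RingQuot (ExtRel N)

instance (N : Submodule ℂ V) : Ring (SuperExt N) := inferInstanceAs (Ring (RingQuot (ExtRel N)))

instance (N : Submodule ℂ V) : Algebra ℂ (SuperExt N) :=
  inferInstanceAs (Algebra ℂ (RingQuot (ExtRel N)))

/-- The quotient map from the tensor algebra. -/
def SuperExt.mk (N : Submodule ℂ V) : TensorAlgebra ℂ N →ₐ[ℂ] SuperExt N :=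
  RingQuot.mkAlgHom ℂ (ExtRel N)

/-- The universal property of the exterior algebra. -/
def SuperExt.lift {N : Submodule ℂ V} {A : Type*} [Semiring A] [Algebra ℂ A]
    (F : TensorAlgebra ℂ N →ₐ[ℂ] A) (h : ∀ ⦃x y⦄, ExtRel N x y → F x = F y) :
    SuperExt N →ₐ[ℂ] A :=
  RingQuot.liftAlgHom ℂ ⟨F, h⟩

theorem SuperExt.lift_mk {N : Submodule ℂ V} {A : Type*} [Semiring A] [Algebra ℂ A]
    (F : TensorAlgebra ℂ N →ₐ[ℂ] A) (h : ∀ ⦃x y⦄, ExtRel N x y → F x = F y)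
    (x : TensorAlgebra ℂ N) : SuperExt.lift F h (SuperExt.mk N x) = F x :=
  RingQuot.liftAlgHom_mkAlgHom_apply ℂ F h x

/-- The inclusion `N → Λ N`. -/
def ext (N : Submodule ℂ V) : N →ₗ[ℂ] SuperExt N :=
  (SuperExt.mk N).toLinearMap ∘ₗ TensorAlgebra.ι ℂ

variable {N : Submodule ℂ V}

theorem ext_mul_ext {i j : ZMod 2} {X Y : N} (hX : (X : V) ∈ gr (V := V) i)
    (hY : (Y : V) ∈ gr (V := V) j) :
    ext N X * ext N Y = -(koszul i j • (ext N Y * ext N X)) := by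
  have h : SuperExt.mk N _ = SuperExt.mk N _ := RingQuot.mkAlgHom_rel ℂ (ExtRel.of i j X Y hX hY)
  rw [map_mul, map_smul, map_mul, neg_smul] at h
  exact h

/-- `Λ N ⊗ W`, the space of chains of `N` with values in `W`. -/
def Chains (N : Submodule ℂ V) (W : Type*) [AddCommGroup W] [Module ℂ W] : Type _ :=
  SuperExt N ⊗[ℂ] W

variable {W : Type*} [AddCommGroup W] [Module ℂ W]

instance : AddCommGroup (Chains N W) := inferInstanceAs (AddCommGroup (SuperExt N ⊗[ℂ] W))

instance : Module ℂ (Chains N W) := inferInstanceAs (Module ℂ (SuperExt N ⊗[ℂ] W))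

variable (N W) in
/-- The bilinear map `(a, w) ↦ a ⊗ w`. -/
def tmul : SuperExt N →ₗ[ℂ] W →ₗ[ℂ] Chains N W := TensorProduct.mk ℂ (SuperExt N) W

variable (N W) in
/-- The space `Λ^k N ⊗ W` of `k`-chains. -/
def chains (k : ℕ) : Submodule ℂ (Chains N W) :=
  Submodule.map₂ (tmul N W) (LinearMap.range (ext N) ^ k) ⊤

theorem Chains.induction {p : Chains N W → Prop} (h0 : p 0) (ht : ∀ a w, p (tmul N W a w))
    (hadd : ∀ f g, p f → p g → p (f + g)) (f : Chains N W) : p f :=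
  TensorProduct.induction_on (motive := p) f h0 ht hadd

/-- A bilinear map on `Λ N × W` as a linear map on `Λ N ⊗ W`. -/
def Chains.lift {M : Type*} [AddCommGroup M] [Module ℂ M] (F : SuperExt N →ₗ[ℂ] W →ₗ[ℂ] M) :
    Chains N W →ₗ[ℂ] M := TensorProduct.lift F

theorem Chains.lift_tmul {M : Type*} [AddCommGroup M] [Module ℂ M]
    (F : SuperExt N →ₗ[ℂ] W →ₗ[ℂ] M) (a : SuperExt N) (w : W) :
    Chains.lift F (tmul N W a w) = F a w := rfl

/-- Left multiplication by an element of `Λ N` on `Λ N ⊗ W`. -/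
def wedge (a : SuperExt N) : Module.End ℂ (Chains N W) :=
  Chains.lift ((tmul N W).comp (LinearMap.mulLeft ℂ a))

theorem wedge_tmul (a b : SuperExt N) (w : W) :
    wedge a (tmul N W b w) = tmul N W (a * b) w := rfl

theorem wedge_mul (a b : SuperExt N) (f : Chains N W) : wedge (a * b) f = wedge a (wedge b f) := by
  induction f using Chains.induction with
  | h0 => simp only [map_zero]
  | ht c w => simp only [wedge_tmul, mul_assoc]
  | hadd f g hf hg => simp only [map_add, hf, hg]

theorem wedge_add (a b : SuperExt N) (f : Chains N W) : wedge (a + b) f = wedge a f + wedge b f := by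
  induction f using Chains.induction with
  | h0 => simp only [map_zero, add_zero]
  | ht c w => simp only [wedge_tmul, add_mul, map_add, LinearMap.add_apply]
  | hadd f g hf hg => simp only [map_add, hf, hg]; abel

theorem wedge_smul (c : ℂ) (a : SuperExt N) (f : Chains N W) :
    wedge (c • a) f = c • wedge a f := by
  induction f using Chains.induction with
  | h0 => simp only [map_zero, smul_zero]
  | ht b w => simp only [wedge_tmul, smul_mul_assoc, map_smul, LinearMap.smul_apply]
  | hadd f g hf hg => simp only [map_add, smul_add, hf, hg]

variable (N W) in
/-- Left multiplication by elements of `Λ N`, as a linear map. -/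
def wedgeL : SuperExt N →ₗ[ℂ] Module.End ℂ (Chains N W) where
  toFun := wedge
  map_add' a b := LinearMap.ext (wedge_add a b)
  map_smul' c a := LinearMap.ext (wedge_smul c a)

theorem wedge_neg (a : SuperExt N) (f : Chains N W) : wedge (-a) f = -wedge a f := by
  rw [← neg_one_smul ℂ a, wedge_smul, neg_one_smul]

theorem wedge_algebraMap (c : ℂ) (f : Chains N W) : wedge (algebraMap ℂ (SuperExt N) c) f = c • f := by
  rw [Algebra.algebraMap_eq_smul_one, wedge_smul]
  congr 1
  induction f using Chains.induction with
  | h0 => simp only [map_zero]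
  | ht b w => rw [wedge_tmul, one_mul]
  | hadd f g hf hg => simp only [map_add, hf, hg]

theorem eq_top_of_wedge {S : Submodule ℂ (Chains N W)} (hW : ∀ w : W, tmul N W 1 w ∈ S)
    (hS : ∀ Y : N, ∀ f ∈ S, wedge (ext N Y) f ∈ S) : S = ⊤ := by
  have key : ∀ t : TensorAlgebra ℂ N, ∀ f ∈ S, wedge (SuperExt.mk N t) f ∈ S := by
    intro t
    induction t using TensorAlgebra.induction with
    | algebraMap r =>
      intro f hf
      rw [AlgHom.commutes, wedge_algebraMap]
      exact S.smul_mem r hf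
    | ι Y => exact hS Y
    | mul a b ha hb =>
      intro f hf
      rw [map_mul, wedge_mul]
      exact ha _ (hb f hf)
    | add a b ha hb =>
      intro f hf
      rw [map_add, wedge_add]
      exact S.add_mem (ha f hf) (hb f hf)
  rw [eq_top_iff]
  rintro f -
  induction f using Chains.induction with
  | h0 => exact S.zero_mem
  | hadd x y hx hy => exact S.add_mem hx hy
  | ht a w =>
    obtain ⟨t, rfl⟩ : ∃ t, SuperExt.mk N t = a := RingQuot.mkAlgHom_surjective ℂ (ExtRel N) a
    have := key t _ (hW w)
    rwa [wedge_tmul, mul_one] at this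

/-- Two operators on `Λ N ⊗ W` that agree on `W`, and on `Y ∧ f` whenever they agree on `f`, for
homogeneous `Y`, are equal. -/
theorem op_ext (hN : IsGraded N) {S T : Module.End ℂ (Chains N W)}
    (hW : ∀ w : W, S (tmul N W 1 w) = T (tmul N W 1 w))
    (hS : ∀ (i : ZMod 2) (Y : N), (Y : V) ∈ gr (V := V) i → ∀ f, S f = T f →
      S (wedge (ext N Y) f) = T (wedge (ext N Y) f)) : S = T := by
  have : LinearMap.eqLocus S T = ⊤ := by
    refine eq_top_of_wedge hW fun Y f hf => ?_
    have hY : Y = ⟨proj 0 (Y : V), hN _ Y.2 0⟩ + ⟨proj 1 (Y : V), hN _ Y.2 1⟩ :=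
      Subtype.ext (proj_add (Y : V)).symm
    rw [hY, map_add, wedge_add]
    exact Submodule.add_mem _ (hS 0 _ (proj_mem 0 _) f hf) (hS 1 _ (proj_mem 1 _) f hf)
  exact LinearMap.ext fun f => by
    have : f ∈ LinearMap.eqLocus S T := this ▸ Submodule.mem_top
    exact this

/-- The data of a recursion `D (Y ∧ f) = P Y f + s Y ∧ D f` on `Λ N ⊗ W`, together with the fact
that it respects the relations of `Λ N`. -/
structure RecData (N : Submodule ℂ V) (W : Type*) [AddCommGroup W] [Module ℂ W] where
  s : N →ₗ[ℂ] N
  P : N →ₗ[ℂ] Module.End ℂ (Chains N W)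
  D₀ : W →ₗ[ℂ] Chains N W
  s_mem : ∀ (i : ZMod 2) (Y : N), (Y : V) ∈ gr (V := V) i → (s Y : V) ∈ gr (V := V) i
  rel : ∀ (i j : ZMod 2) (X Y : N), (X : V) ∈ gr (V := V) i → (Y : V) ∈ gr (V := V) j →
    ∀ f, P X (wedge (ext N Y) f) + wedge (ext N (s X)) (P Y f) =
      -(koszul i j • (P Y (wedge (ext N X) f) + wedge (ext N (s Y)) (P X f)))

theorem wedge_wedge {i j : ZMod 2} {X Y : N} (hX : (X : V) ∈ gr (V := V) i)
    (hY : (Y : V) ∈ gr (V := V) j) (f : Chains N W) :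
    wedge (ext N X) (wedge (ext N Y) f) =
      -(koszul i j • wedge (ext N Y) (wedge (ext N X) f)) := by
  rw [← wedge_mul, ext_mul_ext hX hY, wedge_neg, wedge_smul, wedge_mul]

namespace RecData

variable (R : RecData N W)

/-- The action of `Y` on pairs `(f, D f)`. -/
def step : N →ₗ[ℂ] Module.End ℂ (Chains N W × Chains N W) where
  toFun Y := LinearMap.prod (wedge (ext N Y) ∘ₗ LinearMap.fst ℂ _ _)
    (R.P Y ∘ₗ LinearMap.fst ℂ _ _ + wedge (ext N (R.s Y)) ∘ₗ LinearMap.snd ℂ _ _)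
  map_add' X Y := by
    refine LinearMap.ext fun f => Prod.ext ?_ ?_
    · simp [wedge_add]
    · simp [wedge_add]; abel
  map_smul' c Y := by
    refine LinearMap.ext fun f => Prod.ext ?_ ?_ <;> simp [wedge_smul]

theorem step_apply (Y : N) (f : Chains N W × Chains N W) :
    R.step Y f = (wedge (ext N Y) f.1, R.P Y f.1 + wedge (ext N (R.s Y)) f.2) := rfl

theorem step_rel ⦃x y : TensorAlgebra ℂ N⦄ (h : ExtRel N x y) :
    TensorAlgebra.lift ℂ R.step x = TensorAlgebra.lift ℂ R.step y := by
  obtain ⟨i, j, X, Y, hX, hY⟩ := h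
  rw [map_mul, map_smul, map_mul, TensorAlgebra.lift_ι_apply, TensorAlgebra.lift_ι_apply]
  refine LinearMap.ext fun f => Prod.ext ?_ ?_
  · exact (wedge_wedge hX hY f.1).trans (neg_smul _ _).symm
  · have h1 := R.rel i j X Y hX hY f.1
    have h2 := wedge_wedge (R.s_mem i X hX) (R.s_mem j Y hY) f.2
    simp only [Module.End.mul_apply, step_apply, LinearMap.smul_apply, map_add, neg_smul,
      Prod.snd_neg, Prod.smul_snd]
    rw [← add_assoc, h1, h2, ← neg_add, ← smul_add, add_assoc]

/-- The algebra morphism extending `step`. -/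
def stepHom : SuperExt N →ₐ[ℂ] Module.End ℂ (Chains N W × Chains N W) :=
  SuperExt.lift (TensorAlgebra.lift ℂ R.step) R.step_rel

theorem stepHom_ext (Y : N) : R.stepHom (ext N Y) = R.step Y := by
  simp [stepHom, ext, SuperExt.lift_mk]

/-- The pair `(f, D f)`. -/
def pair : Chains N W →ₗ[ℂ] Chains N W × Chains N W :=
  Chains.lift (LinearMap.compl₂ R.stepHom.toLinearMap (LinearMap.prod (tmul N W 1) R.D₀))

theorem pair_tmul (a : SuperExt N) (w : W) :
    R.pair (tmul N W a w) = R.stepHom a (tmul N W 1 w, R.D₀ w) := rfl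

theorem pair_one (w : W) : R.pair (tmul N W 1 w) = (tmul N W 1 w, R.D₀ w) := by
  rw [pair_tmul, map_one, Module.End.one_apply]

theorem pair_wedge (Y : N) (f : Chains N W) :
    R.pair (wedge (ext N Y) f) = R.step Y (R.pair f) := by
  induction f using Chains.induction with
  | h0 => simp only [map_zero]
  | hadd x y hx hy => simp only [map_add, hx, hy]
  | ht a w => rw [wedge_tmul, ← stepHom_ext, pair_tmul, pair_tmul, map_mul, Module.End.mul_apply]

theorem pair_fst (f : Chains N W) : (R.pair f).1 = f := by
  have : LinearMap.eqLocus (LinearMap.fst ℂ _ _ ∘ₗ R.pair) LinearMap.id = ⊤ := by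
    refine eq_top_of_wedge (fun w => ?_) fun Y f hf => ?_
    · simp [pair_one]
    · have hf' : (R.pair f).1 = f := hf
      simp [pair_wedge, step_apply, hf']
  have h : f ∈ LinearMap.eqLocus (LinearMap.fst ℂ _ _ ∘ₗ R.pair) LinearMap.id :=
    this ▸ Submodule.mem_top
  exact h

/-- The operator `D` with `D w = D₀ w` and `D (Y ∧ f) = P Y f + s Y ∧ D f`. -/
def op : Module.End ℂ (Chains N W) := LinearMap.snd ℂ _ _ ∘ₗ R.pair

theorem op_one (w : W) : R.op (tmul N W 1 w) = R.D₀ w := by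
  simp [op, pair_one]

theorem op_wedge (Y : N) (f : Chains N W) :
    R.op (wedge (ext N Y) f) = R.P Y f + wedge (ext N (R.s Y)) (R.op f) := by
  simp [op, pair_wedge, step_apply, pair_fst]

end RecData

theorem chains_zero_le {S : Submodule ℂ (Chains N W)} (hS : ∀ w, tmul N W 1 w ∈ S) :
    chains N W 0 ≤ S := by
  refine Submodule.map₂_le.2 fun a ha w _ => ?_
  rw [pow_zero, Submodule.mem_one] at ha
  obtain ⟨c, rfl⟩ := ha
  rw [Algebra.algebraMap_eq_smul_one, map_smul, LinearMap.smul_apply]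
  exact S.smul_mem c (hS w)

theorem chains_succ_le {k : ℕ} {S : Submodule ℂ (Chains N W)}
    (hS : ∀ Y, ∀ f ∈ chains N W k, wedge (ext N Y) f ∈ S) : chains N W (k + 1) ≤ S := by
  refine Submodule.map₂_le.2 fun a ha w _ => ?_
  rw [pow_succ'] at ha
  induction ha using Submodule.mul_induction_on' with
  | mem_mul_mem m hm n hn =>
    obtain ⟨Y, rfl⟩ := hm
    exact hS Y _ (Submodule.apply_mem_map₂ _ hn Submodule.mem_top)
  | add x _ y _ hx hy =>
    rw [map_add, LinearMap.add_apply]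
    exact S.add_mem hx hy

theorem one_mem_chains (w : W) : tmul N W 1 w ∈ chains N W 0 :=
  Submodule.apply_mem_map₂ _ (by rw [pow_zero]; exact Submodule.one_le.1 le_rfl) Submodule.mem_top

theorem wedge_mem_chains {k : ℕ} (Y : N) {f : Chains N W} (hf : f ∈ chains N W k) :
    wedge (ext N Y) f ∈ chains N W (k + 1) := by
  have : chains N W k ≤ (chains N W (k + 1)).comap (wedge (ext N Y)) := by
    refine Submodule.map₂_le.2 fun a ha w _ => ?_
    rw [Submodule.mem_comap, wedge_tmul]
    refine Submodule.apply_mem_map₂ _ ?_ Submodule.mem_top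
    rw [pow_succ']
    exact Submodule.mul_mem_mul ⟨Y, rfl⟩ ha
  exact this hf

end Exterior


/-! ### Lie superalgebras and their modules -/

/-- A complex Lie superalgebra, with superbracket `br`. -/
class LieSuperalgebra (g : Type*) [AddCommGroup g] [Module ℂ g] extends SuperSpace g where
  br : g →ₗ[ℂ] g →ₗ[ℂ] g
  br_mem : ∀ {i j : ZMod 2} {x y : g}, x ∈ gr i → y ∈ gr j → br x y ∈ gr (i + j)
  br_skew : ∀ {i j : ZMod 2} {x y : g}, x ∈ gr i → y ∈ gr j → br x y = -(koszul i j • br y x)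
  jacobi : ∀ {i j : ZMod 2} {x y : g}, x ∈ gr i → y ∈ gr j → ∀ z : g,
    br x (br y z) = br (br x y) z + koszul i j • br y (br x z)

open LieSuperalgebra

/-- A (left, graded) module of a Lie superalgebra `g` on a super vector space `W`. -/
class LieSupermodule (g W : Type*) [AddCommGroup g] [Module ℂ g] [LieSuperalgebra g]
    [AddCommGroup W] [Module ℂ W] [SuperSpace W] where
  smul : g →ₗ[ℂ] W →ₗ[ℂ] W
  smul_mem : ∀ {i j : ZMod 2} {x : g} {w : W}, x ∈ gr (V := g) i → w ∈ gr (V := W) j →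
    smul x w ∈ gr (V := W) (i + j)
  br_smul : ∀ {i j : ZMod 2} {x y : g}, x ∈ gr (V := g) i → y ∈ gr (V := g) j → ∀ w : W,
    smul (br x y) w = smul x (smul y w) - koszul i j • smul y (smul x w)

section Lie

variable {g : Type*} [AddCommGroup g] [Module ℂ g] [LieSuperalgebra g]

/-- `h` is a Cartan subalgebra of the (reductive) even part: an abelian subalgebra of `g_0` that
is its own normaliser in `g_0`. -/
structure IsCartan (h : Submodule ℂ g) : Prop where
  le_even : h ≤ gr (V := g) 0
  abelian : ∀ x ∈ h, ∀ y ∈ h, br x y = 0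
  self_normalizing : ∀ x ∈ gr (V := g) 0, (∀ y ∈ h, br x y ∈ h) → x ∈ h

variable (g) in
/-- A parabolic subalgebra `p = l + n` of `g` together with the decomposition `g = n̄ + l + n`. It
is given by a `ℤ`-grading of the Lie superalgebra `g` whose part `l` of degree `0` contains a Cartan
subalgebra; `n` and `n̄` are the parts of positive and of negative degree. (For a subalgebra that
contains a Borel subalgebra, give the simple root vectors in the Levi subalgebra degree `0` and the
other simple root vectors degree `1`. Conversely, a generic refinement of such a grading, with the
Cartan subalgebra in degree `0`, gives a Borel subalgebra contained in `p`.) -/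
structure Parabolic where
  deg : ℤ → Submodule ℂ g
  isInternal : DirectSum.IsInternal deg
  isGraded : ∀ k, IsGraded (deg k)
  br_mem_deg : ∀ {k l : ℤ} {x y : g}, x ∈ deg k → y ∈ deg l → br x y ∈ deg (k + l)
  exists_cartan : ∃ h : Submodule ℂ g, IsCartan h ∧ h ≤ deg 0

namespace Parabolic

variable (P : Parabolic g)

/-- The Levi subalgebra `l`. -/
def levi : Submodule ℂ g := P.deg 0

/-- The nilradical `n`. -/
def n : Submodule ℂ g := ⨆ k : {k : ℤ // 0 < k}, P.deg k

/-- The opposite nilradical `n̄`. -/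
def nbar : Submodule ℂ g := ⨆ k : {k : ℤ // k < 0}, P.deg k

/-- The parabolic subalgebra `p = l + n`. -/
def p : Submodule ℂ g := P.levi ⊔ P.n

theorem isCompl : IsCompl P.nbar P.p := by
  have e1 : P.nbar = ⨆ k ∈ {k : ℤ | k < 0}, P.deg k := by rw [nbar, iSup_subtype]; rfl
  have e2 : P.p = ⨆ k ∈ {k : ℤ | 0 ≤ k}, P.deg k := by
    apply le_antisymm
    · refine sup_le (le_biSup P.deg (le_refl (0 : ℤ))) (iSup_le fun k => ?_)
      exact le_biSup P.deg (show (k : ℤ) ∈ {k : ℤ | 0 ≤ k} from k.2.le)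
    · refine iSup₂_le fun k hk => ?_
      rcases eq_or_lt_of_le (show 0 ≤ k from hk) with rfl | h
      · exact le_sup_left
      · exact (le_iSup (fun k : {k : ℤ // 0 < k} => P.deg k) ⟨k, h⟩).trans le_sup_right
  constructor
  · rw [e1, e2]
    refine P.isInternal.submodule_iSupIndep.disjoint_biSup_biSup ?_
    rw [Set.disjoint_left]
    intro k hk hk'
    exact absurd (show k < 0 from hk) (not_lt.2 hk')
  · rw [codisjoint_iff, eq_top_iff, ← P.isInternal.submodule_iSup_eq_top]
    refine iSup_le fun k => ?_
    rcases lt_or_ge k 0 with h | h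
    · rw [e1]
      exact (le_biSup P.deg (show k ∈ {k : ℤ | k < 0} from h)).trans le_sup_left
    · rw [e2]
      exact (le_biSup P.deg (show k ∈ {k : ℤ | 0 ≤ k} from h)).trans le_sup_right

theorem isGraded_nbar : IsGraded P.nbar := IsGraded.iSup fun k => P.isGraded k

theorem isGraded_p : IsGraded P.p :=
  IsGraded.sup (P.isGraded 0) (IsGraded.iSup fun k => P.isGraded k)

/-- The projection `[·]_{n̄}` of `g` onto `n̄` along `p`. -/
def toNbar : g →ₗ[ℂ] P.nbar := P.nbar.projectionOnto P.p P.isCompl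

theorem toNbar_of_mem {x : g} (hx : x ∈ P.nbar) : (P.toNbar x : g) = x := by
  rw [toNbar, Submodule.projectionOnto_apply_of_mem_left _ hx]

theorem toNbar_mem {i : ZMod 2} {x : g} (hx : x ∈ gr (V := g) i) :
    (P.toNbar x : g) ∈ gr (V := g) i := by
  obtain ⟨a, ha, b, hb, rfl⟩ := Submodule.mem_sup.1
    (P.isCompl.codisjoint.eq_top ▸ Submodule.mem_top : x ∈ P.nbar ⊔ P.p)
  have h := proj_of_mem hx i
  rw [if_pos rfl, map_add] at h
  rw [← h, map_add, toNbar,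
    (Submodule.projectionOnto_apply_eq_zero_iff P.isCompl).2 (P.isGraded_p b hb i), add_zero,
    Submodule.projectionOnto_apply_of_mem_left _ (P.isGraded_nbar a ha i)]
  exact proj_mem i a

theorem br_levi_nbar {x y : g} (hx : x ∈ P.levi) (hy : y ∈ P.nbar) : br x y ∈ P.nbar := by
  have : P.nbar ≤ P.nbar.comap (br x) := iSup_le fun k y hy => by
    have := P.br_mem_deg hx hy
    rw [zero_add] at this
    exact Submodule.mem_iSup_of_mem k this
  exact this hy

theorem br_nbar_nbar {x y : g} (hx : x ∈ P.nbar) (hy : y ∈ P.nbar) : br x y ∈ P.nbar := by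
  have h1 : P.nbar ≤ P.nbar.comap (br.flip y) := iSup_le fun l x hx => by
    have h2 : P.nbar ≤ P.nbar.comap (br x) := iSup_le fun k y hy =>
      Submodule.mem_iSup_of_mem (⟨l + k, add_neg l.2 k.2⟩ : {k : ℤ // k < 0}) (P.br_mem_deg hx hy)
    exact h2 hy
  exact h1 hx

end Parabolic

/-! ### The operators on `C(n, W) = Λ n̄ ⊗ W` -/

section Operators

variable (P : Parabolic g) (W : Type*) [AddCommGroup W] [Module ℂ W] [SuperSpace W]
  [LieSupermodule g W]

/-- The restriction of `twist a` to `n̄`. -/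
def twistN (a : ZMod 2) : P.nbar →ₗ[ℂ] P.nbar :=
  (twist a).restrict (P.isGraded_nbar.twist_mem a)

theorem twistN_of_mem (a : ZMod 2) {i : ZMod 2} {Y : P.nbar} (hY : (Y : g) ∈ gr (V := g) i) :
    twistN P a Y = koszul a i • Y := Subtype.ext (twist_of_mem a hY)

theorem twistN_mem (a i : ZMod 2) (Y : P.nbar) (hY : (Y : g) ∈ gr (V := g) i) :
    (twistN P a Y : g) ∈ gr (V := g) i := by
  rw [twistN_of_mem P a hY]
  exact Submodule.smul_mem _ _ hY

/-- The operator `Y ↦ [A, Y]_{n̄}` on `n̄`. -/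
def adN (A : g) : P.nbar →ₗ[ℂ] P.nbar := P.toNbar ∘ₗ br A ∘ₗ P.nbar.subtype

theorem adN_mem {a i : ZMod 2} {A : g} (hA : A ∈ gr (V := g) a) {Y : P.nbar}
    (hY : (Y : g) ∈ gr (V := g) i) : (adN P A Y : g) ∈ gr (V := g) (a + i) :=
  P.toNbar_mem (br_mem hA hY)

theorem adN_add (A B : g) (Y : P.nbar) : adN P (A + B) Y = adN P A Y + adN P B Y := by
  simp [adN]

theorem adN_smul (c : ℂ) (A : g) (Y : P.nbar) : adN P (c • A) Y = c • adN P A Y := by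
  simp [adN]

theorem act_rel {a : ZMod 2} {A : g} (hA : A ∈ gr (V := g) a) {i j : ZMod 2} {X Y : P.nbar}
    (hX : (X : g) ∈ gr (V := g) i) (hY : (Y : g) ∈ gr (V := g) j) (f : Chains P.nbar W) :
    wedge (ext _ (adN P A X)) (wedge (ext _ Y) f) +
        wedge (ext _ (twistN P a X)) (wedge (ext _ (adN P A Y)) f) =
      -(koszul i j • (wedge (ext _ (adN P A Y)) (wedge (ext _ X) f) +
        wedge (ext _ (twistN P a Y)) (wedge (ext _ (adN P A X)) f))) := by
  have h1 := wedge_wedge (adN_mem P hA hX) hY f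
  have h2 := wedge_wedge hX (adN_mem P hA hY) f
  rw [twistN_of_mem P a hX, twistN_of_mem P a hY, map_smul, map_smul, wedge_smul, wedge_smul, h1,
    h2, koszul_add_left, koszul_add_right, koszul_comm i a]
  have e1 := koszul_sq a i
  match_scalars
  · ring
  · linear_combination (-koszul i j) * e1

/-- The action `A[f]` of a homogeneous element `A` of parity `a` is given by `A[w] = A w` and
`A[Y ∧ f] = [A, Y]_{n̄} ∧ f + (-1)^{a|Y|} Y ∧ A[f]`. -/
def actData (a : ZMod 2) (A : g) (hA : A ∈ gr (V := g) a) : RecData P.nbar W where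
  s := twistN P a
  P := wedgeL P.nbar W ∘ₗ ext P.nbar ∘ₗ adN P A
  D₀ := tmul P.nbar W 1 ∘ₗ LieSupermodule.smul A
  s_mem := twistN_mem P a
  rel _ _ _ _ hX hY f := act_rel P W hA hX hY f

/-- The operator on `Λ n̄ ⊗ W` given by a homogeneous element of `g`. -/
def actHom (a : ZMod 2) (A : g) (hA : A ∈ gr (V := g) a) : Module.End ℂ (Chains P.nbar W) :=
  (actData P W a A hA).op

theorem actHom_one (a : ZMod 2) (A : g) (hA : A ∈ gr (V := g) a) (w : W) :
    actHom P W a A hA (tmul _ W 1 w) = tmul _ W 1 (LieSupermodule.smul A w) :=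
  RecData.op_one _ w

theorem actHom_wedge (a : ZMod 2) (A : g) (hA : A ∈ gr (V := g) a) (Y : P.nbar)
    (f : Chains P.nbar W) :
    actHom P W a A hA (wedge (ext _ Y) f) =
      wedge (ext _ (adN P A Y)) f + wedge (ext _ (twistN P a Y)) (actHom P W a A hA f) :=
  RecData.op_wedge _ Y f

theorem actHom_zero (a : ZMod 2) {A : g} (hA : A ∈ gr (V := g) a) (h0 : A = 0) :
    actHom P W a A hA = 0 := by
  subst h0
  refine op_ext P.isGraded_nbar (fun w => ?_) fun i Y hY f hf => ?_
  · simp [actHom_one]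
  · have : wedge (ext P.nbar (adN P 0 Y)) f = 0 := by
      rw [← zero_smul ℂ (0 : g), adN_smul, zero_smul, map_zero, ← zero_smul ℂ (0 : SuperExt P.nbar),
        wedge_smul, zero_smul]
    rw [actHom_wedge, hf, this, LinearMap.zero_apply, LinearMap.zero_apply, map_zero, add_zero]

/-- The action `A[f]` of `g` on `Λ n̄ ⊗ W`; its restriction to `p^* = n̄ + l` is a module
structure. -/
def act : g →ₗ[ℂ] Module.End ℂ (Chains P.nbar W) where
  toFun A := actHom P W 0 (proj 0 A) (proj_mem 0 A) + actHom P W 1 (proj 1 A) (proj_mem 1 A)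
  map_add' A B := by
    have key : ∀ a : ZMod 2, actHom P W a (proj a (A + B)) (proj_mem a _) =
        actHom P W a (proj a A) (proj_mem a _) + actHom P W a (proj a B) (proj_mem a _) := by
      intro a
      refine op_ext P.isGraded_nbar (fun w => ?_) fun i Y hY f hf => ?_
      · simp [actHom_one]
      · rw [LinearMap.add_apply] at hf ⊢
        rw [actHom_wedge, actHom_wedge, actHom_wedge, hf, map_add, adN_add, map_add, map_add,
          wedge_add]
        abel
    rw [key, key]; abel
  map_smul' c A := by
    have key : ∀ a : ZMod 2, actHom P W a (proj a (c • A)) (proj_mem a _) =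
        c • actHom P W a (proj a A) (proj_mem a _) := by
      intro a
      refine op_ext P.isGraded_nbar (fun w => ?_) fun i Y hY f hf => ?_
      · simp [actHom_one]
      · rw [LinearMap.smul_apply] at hf ⊢
        rw [actHom_wedge, actHom_wedge, hf, map_smul, adN_smul, map_smul, map_smul, wedge_smul,
          smul_add]
    rw [key, key, RingHom.id_apply, smul_add]

theorem act_eq {a : ZMod 2} {A : g} (hA : A ∈ gr (V := g) a) : act P W A = actHom P W a A hA := by
  have h0 := proj_of_mem hA 0
  have h1 := proj_of_mem hA 1
  simp only [act, LinearMap.coe_mk, AddHom.coe_mk]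
  rcases zmod_two a with rfl | rfl
  · rw [actHom_zero P W 1 _ (by simpa using h1), add_zero]
    congr 1
  · rw [actHom_zero P W 0 _ (by simpa using h0), zero_add]
    congr 1

variable {W}

theorem act_one (A : g) (w : W) :
    act P W A (tmul _ W 1 w) = tmul _ W 1 (LieSupermodule.smul A w) := by
  simp only [act, LinearMap.coe_mk, AddHom.coe_mk, LinearMap.add_apply, actHom_one]
  rw [← map_add, ← LinearMap.add_apply, ← map_add, proj_add]

theorem act_wedge {a i : ZMod 2} {A : g} (hA : A ∈ gr (V := g) a) {Y : P.nbar}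
    (hY : (Y : g) ∈ gr (V := g) i) (f : Chains P.nbar W) :
    act P W A (wedge (ext _ Y) f) =
      wedge (ext _ (adN P A Y)) f + koszul a i • wedge (ext _ Y) (act P W A f) := by
  rw [act_eq P W hA, actHom_wedge, twistN_of_mem P a hY, map_smul, wedge_smul]

/-- On `n̄ + l`, and more generally on elements that normalise `n̄`, the action is compatible with
the bracket. -/
theorem act_br {a b : ZMod 2} {A B : g} (hA : A ∈ gr (V := g) a) (hB : B ∈ gr (V := g) b)
    (hA' : ∀ y ∈ P.nbar, br A y ∈ P.nbar) (hB' : ∀ y ∈ P.nbar, br B y ∈ P.nbar)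
    (f : Chains P.nbar W) :
    act P W A (act P W B f) = act P W (br A B) f + koszul a b • act P W B (act P W A f) := by
  suffices h : act P W A * act P W B = act P W (br A B) + koszul a b • (act P W B * act P W A) from
    LinearMap.congr_fun h f
  have hC := br_mem hA hB
  refine op_ext P.isGraded_nbar (fun w => ?_) fun i Y hY f hf => ?_
  · simp only [Module.End.mul_apply, LinearMap.add_apply, LinearMap.smul_apply, act_one]
    rw [LieSupermodule.br_smul hA hB, map_sub, map_smul, sub_add_cancel]
  · simp only [Module.End.mul_apply, LinearMap.add_apply, LinearMap.smul_apply] at hf ⊢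
    have eA : ∀ Z : P.nbar, (adN P A Z : g) = br A Z := fun Z => P.toNbar_of_mem (hA' _ Z.2)
    have eB : ∀ Z : P.nbar, (adN P B Z : g) = br B Z := fun Z => P.toNbar_of_mem (hB' _ Z.2)
    have e : adN P A (adN P B Y) = adN P (br A B) Y + koszul a b • adN P B (adN P A Y) := by
      apply Subtype.ext
      have hj := jacobi hA hB (Y : g)
      have hmem : br (br A B) (Y : g) ∈ P.nbar := by
        rw [eq_sub_of_add_eq hj.symm]
        exact P.nbar.sub_mem (hA' _ (hB' _ Y.2)) (P.nbar.smul_mem _ (hB' _ (hA' _ Y.2)))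
      have eC : (adN P (br A B) Y : g) = br (br A B) Y := P.toNbar_of_mem hmem
      rw [Submodule.coe_add, Submodule.coe_smul, eA, eB, eB, eA, eC, hj]
    rw [act_wedge P hB hY, act_wedge P hA hY, act_wedge P hC hY]
    simp only [map_add, map_smul]
    rw [act_wedge P hA hY, act_wedge P hB hY, act_wedge P hA (adN_mem P hB hY),
      act_wedge P hB (adN_mem P hA hY), e, hf]
    simp only [map_add, map_smul, wedge_add, wedge_smul, koszul_add_left, koszul_add_right,
      koszul_comm b a]
    have e1 := koszul_sq a b
    match_scalars
    all_goals first | linear_combination (-koszul b i) * e1 | ring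

variable (W)

/-- The boundary operator `δ^*` is given by `δ^* w = 0` and `δ^*(Y ∧ f) = -Y · f - Y ∧ δ^* f`. -/
def boundaryData : RecData P.nbar W where
  s := -LinearMap.id
  P := -(act P W ∘ₗ P.nbar.subtype)
  D₀ := 0
  s_mem _ _ hY := Submodule.neg_mem _ hY
  rel i j X Y hX hY f := by
    have eX : (adN P (X : g) Y : g) = br (X : g) (Y : g) :=
      P.toNbar_of_mem (P.br_nbar_nbar X.2 Y.2)
    have eY : (adN P (Y : g) X : g) = br (Y : g) (X : g) :=
      P.toNbar_of_mem (P.br_nbar_nbar Y.2 X.2)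
    have e : adN P (X : g) Y = -(koszul i j • adN P (Y : g) X) := by
      apply Subtype.ext
      rw [Submodule.coe_neg, Submodule.coe_smul, eX, eY, br_skew hX hY]
    simp only [LinearMap.neg_apply, LinearMap.id_apply, LinearMap.comp_apply,
      Submodule.subtype_apply, map_neg, wedge_neg]
    rw [act_wedge P hX hY, act_wedge P hY hX, e, koszul_comm j i]
    simp only [map_neg, map_smul, wedge_neg, wedge_smul]
    have e1 := koszul_sq i j
    match_scalars
    all_goals first | linear_combination e1 | linear_combination -e1 | ring

/-- The boundary operator `δ^*`. -/
def boundary : Module.End ℂ (Chains P.nbar W) := (boundaryData P W).op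

variable {W}

theorem boundary_one (w : W) : boundary P W (tmul _ W 1 w) = 0 :=
  RecData.op_one _ w

theorem boundary_wedge (Y : P.nbar) (f : Chains P.nbar W) :
    boundary P W (wedge (ext _ Y) f) = -act P W (Y : g) f - wedge (ext _ Y) (boundary P W f) := by
  refine (RecData.op_wedge _ Y f).trans ?_
  change -act P W (Y : g) f + wedge (ext _ (-Y)) (boundary P W f) = _
  rw [map_neg, wedge_neg, sub_eq_add_neg]

theorem boundary_act {a : ZMod 2} {A : g} (hA : A ∈ gr (V := g) a)
    (hA' : ∀ y ∈ P.nbar, br A y ∈ P.nbar) (f : Chains P.nbar W) :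
    boundary P W (act P W A f) = act P W A (boundary P W f) := by
  suffices h : boundary P W * act P W A = act P W A * boundary P W from LinearMap.congr_fun h f
  refine op_ext P.isGraded_nbar (fun w => ?_) fun i Y hY f hf => ?_
  · simp only [Module.End.mul_apply, act_one, boundary_one, map_zero]
  · simp only [Module.End.mul_apply] at hf ⊢
    have eA : (adN P A Y : g) = br A Y := P.toNbar_of_mem (hA' _ Y.2)
    rw [act_wedge P hA hY, map_add, map_smul, boundary_wedge, boundary_wedge, boundary_wedge, hf,
      map_sub, map_neg, act_wedge P hA hY, eA,
      act_br P hA hY hA' (fun y hy => P.br_nbar_nbar Y.2 hy)]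
    simp only [smul_sub, smul_neg]
    abel

theorem boundary_act_nbar (Y : P.nbar) (f : Chains P.nbar W) :
    boundary P W (act P W (Y : g) f) = act P W (Y : g) (boundary P W f) := by
  have h : ∀ i, boundary P W (act P W (proj i (Y : g)) f) =
      act P W (proj i (Y : g)) (boundary P W f) := fun i =>
    boundary_act P (proj_mem i _)
      (fun y hy => P.br_nbar_nbar (P.isGraded_nbar _ Y.2 i) hy) f
  rw [← proj_add (Y : g), map_add, LinearMap.add_apply, LinearMap.add_apply, map_add, h, h]

theorem boundary_act_levi (A : P.levi) (f : Chains P.nbar W) :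
    boundary P W (act P W (A : g) f) = act P W (A : g) (boundary P W f) := by
  have h : ∀ i, boundary P W (act P W (proj i (A : g)) f) =
      act P W (proj i (A : g)) (boundary P W f) := fun i =>
    boundary_act P (proj_mem i _)
      (fun y hy => P.br_levi_nbar (P.isGraded 0 _ A.2 i) hy) f
  rw [← proj_add (A : g), map_add, LinearMap.add_apply, LinearMap.add_apply, map_add, h, h]

theorem boundary_boundary (f : Chains P.nbar W) : boundary P W (boundary P W f) = 0 := by
  suffices h : boundary P W * boundary P W = 0 from LinearMap.congr_fun h f
  refine op_ext P.isGraded_nbar (fun w => ?_) fun i Y hY f hf => ?_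
  · simp only [Module.End.mul_apply, boundary_one, map_zero, LinearMap.zero_apply]
  · simp only [Module.End.mul_apply, LinearMap.zero_apply] at hf ⊢
    rw [boundary_wedge, map_sub, map_neg, boundary_act_nbar, boundary_wedge, hf, map_zero]
    abel

variable (W)

/-- The parity involution of `Λ n̄ ⊗ W`. -/
def parityData : RecData P.nbar W where
  s := twistN P 1
  P := 0
  D₀ := tmul P.nbar W 1 ∘ₗ twist 1
  s_mem := twistN_mem P 1
  rel _ _ _ _ _ _ _ := by simp

/-- The parity involution `f ↦ (-1)^{|f|} f` of `Λ n̄ ⊗ W`. -/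
def parityOp : Module.End ℂ (Chains P.nbar W) := (parityData P W).op

variable {W}

theorem parityOp_one (w : W) : parityOp P W (tmul _ W 1 w) = tmul _ W 1 (twist 1 w) :=
  RecData.op_one _ w

theorem parityOp_wedge {i : ZMod 2} {Y : P.nbar} (hY : (Y : g) ∈ gr (V := g) i)
    (f : Chains P.nbar W) :
    parityOp P W (wedge (ext _ Y) f) = koszul 1 i • wedge (ext _ Y) (parityOp P W f) := by
  refine (RecData.op_wedge _ Y f).trans ?_
  change 0 + wedge (ext _ (twistN P 1 Y)) (parityOp P W f) = _
  rw [twistN_of_mem P 1 hY, map_smul, wedge_smul, zero_add]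

theorem parityOp_act {a : ZMod 2} {A : g} (hA : A ∈ gr (V := g) a) (f : Chains P.nbar W) :
    parityOp P W (act P W A f) = koszul 1 a • act P W A (parityOp P W f) := by
  suffices h : parityOp P W * act P W A = koszul 1 a • (act P W A * parityOp P W) from
    LinearMap.congr_fun h f
  refine op_ext P.isGraded_nbar (fun w => ?_) fun i Y hY f hf => ?_
  · simp only [Module.End.mul_apply, LinearMap.smul_apply, act_one, parityOp_one]
    rw [← map_smul]
    congr 1
    have h : ∀ j, twist 1 (LieSupermodule.smul A (proj j w)) =
        koszul 1 a • LieSupermodule.smul A (twist 1 (proj j w)) := by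
      intro j
      rw [twist_of_mem 1 (LieSupermodule.smul_mem hA (proj_mem j w)), twist_of_mem 1 (proj_mem j w),
        koszul_add_right, map_smul, smul_smul]
    rw [← proj_add w]
    simp only [map_add, smul_add, h]
  · simp only [Module.End.mul_apply, LinearMap.smul_apply] at hf ⊢
    rw [act_wedge P hA hY, map_add, map_smul, parityOp_wedge P (adN_mem P hA hY),
      parityOp_wedge P hY, parityOp_wedge P hY, hf, map_smul, map_smul, act_wedge P hA hY,
      koszul_add_right]
    simp only [smul_add, smul_smul]
    congr 2
    ring

theorem parityOp_boundary (f : Chains P.nbar W) :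
    parityOp P W (boundary P W f) = boundary P W (parityOp P W f) := by
  suffices h : parityOp P W * boundary P W = boundary P W * parityOp P W from
    LinearMap.congr_fun h f
  refine op_ext P.isGraded_nbar (fun w => ?_) fun i Y hY f hf => ?_
  · simp only [Module.End.mul_apply, parityOp_one, boundary_one, map_zero]
  · simp only [Module.End.mul_apply] at hf ⊢
    rw [boundary_wedge, map_sub, map_neg, parityOp_act P hY, parityOp_wedge P hY,
      parityOp_wedge P hY, map_smul, boundary_wedge, hf, smul_sub, smul_neg]

/-! ### Homology -/

theorem actHom_mem_chains (a : ZMod 2) (A : g) (hA : A ∈ gr (V := g) a) (k : ℕ) :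
    chains P.nbar W k ≤ (chains P.nbar W k).comap (actHom P W a A hA) := by
  induction k with
  | zero =>
    refine chains_zero_le fun w => ?_
    rw [Submodule.mem_comap, actHom_one]
    exact one_mem_chains _
  | succ k ih =>
    refine chains_succ_le fun Y f hf => ?_
    rw [Submodule.mem_comap, actHom_wedge]
    exact Submodule.add_mem _ (wedge_mem_chains _ hf) (wedge_mem_chains _ (ih hf))

theorem act_mem_chains (A : g) (k : ℕ) :
    chains P.nbar W k ≤ (chains P.nbar W k).comap (act P W A) := by
  intro f hf
  have h : act P W A f = actHom P W 0 (proj 0 A) (proj_mem 0 A) f +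
      actHom P W 1 (proj 1 A) (proj_mem 1 A) f := rfl
  rw [Submodule.mem_comap, h]
  exact Submodule.add_mem _ (actHom_mem_chains P 0 _ (proj_mem 0 A) k hf)
    (actHom_mem_chains P 1 _ (proj_mem 1 A) k hf)

theorem parityOp_mem_chains (k : ℕ) :
    chains P.nbar W k ≤ (chains P.nbar W k).comap (parityOp P W) := by
  induction k with
  | zero =>
    refine chains_zero_le fun w => ?_
    rw [Submodule.mem_comap, parityOp_one]
    exact one_mem_chains _
  | succ k ih =>
    refine chains_succ_le fun Y f hf => ?_
    have h : parityOp P W (wedge (ext _ Y) f) = 0 + wedge (ext _ (twistN P 1 Y)) (parityOp P W f) :=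
      RecData.op_wedge _ Y f
    rw [Submodule.mem_comap, h, zero_add]
    exact wedge_mem_chains _ (ih hf)

theorem boundary_mem_chains (k : ℕ) :
    chains P.nbar W (k + 1) ≤ (chains P.nbar W k).comap (boundary P W) := by
  induction k with
  | zero =>
    refine chains_succ_le fun Y f hf => ?_
    have h0 : chains P.nbar W 0 ≤ LinearMap.ker (boundary P W) :=
      chains_zero_le fun w => boundary_one P w
    have hf0 : boundary P W f = 0 := h0 hf
    rw [Submodule.mem_comap, boundary_wedge, hf0, map_zero, sub_zero]
    exact Submodule.neg_mem _ (act_mem_chains P _ 0 hf)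
  | succ k ih =>
    refine chains_succ_le fun Y f hf => ?_
    rw [Submodule.mem_comap, boundary_wedge]
    exact Submodule.sub_mem _ (Submodule.neg_mem _ (act_mem_chains P _ _ hf))
      (wedge_mem_chains _ (ih hf))

variable (W)

/-- The `k`-cycles: `ker δ^*` in degree `k`. -/
def cycles (k : ℕ) : Submodule ℂ (Chains P.nbar W) :=
  LinearMap.ker (boundary P W) ⊓ chains P.nbar W k

/-- The `k`-boundaries: the image of `δ^*` on `k + 1`-chains. -/
def boundaries (k : ℕ) : Submodule ℂ (Chains P.nbar W) :=
  (chains P.nbar W (k + 1)).map (boundary P W)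

theorem boundaries_le_cycles (k : ℕ) : boundaries P W k ≤ cycles P W k :=
  Submodule.map_le_iff_le_comap.2 fun f hf =>
    ⟨boundary_boundary P f, boundary_mem_chains P k hf⟩

/-- The homology `H_k(n̄, W)`. -/
abbrev Homology (k : ℕ) : Type _ :=
  cycles P W k ⧸ (boundaries P W k).submoduleOf (cycles P W k)

/-- The operator on homology induced by an operator on chains that commutes with `δ^*`. -/
def homologyMap (k : ℕ) (T : Module.End ℂ (Chains P.nbar W))
    (hT : ∀ k, chains P.nbar W k ≤ (chains P.nbar W k).comap T)
    (hc : ∀ f, boundary P W (T f) = T (boundary P W f)) : Module.End ℂ (Homology P W k) :=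
  Submodule.mapQ _ _
    (T.restrict (p := cycles P W k) (q := cycles P W k) fun f hf =>
      ⟨LinearMap.mem_ker.2 (by rw [hc, LinearMap.mem_ker.1 hf.1, map_zero]), hT k hf.2⟩)
    (by
      rintro ⟨f, hf⟩ ⟨e, he, hef⟩
      exact ⟨T e, hT _ he, by rw [hc, hef]; rfl⟩)

/-- The action of the Levi subalgebra `l` on `H_k(n̄, W)`. -/
def homologyAct (k : ℕ) (A : P.levi) : Module.End ℂ (Homology P W k) :=
  homologyMap P W k (act P W (A : g)) (act_mem_chains P _) (boundary_act_levi P A)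

/-- The parity involution of `H_k(n̄, W)`. -/
def homologyParity (k : ℕ) : Module.End ℂ (Homology P W k) :=
  homologyMap P W k (parityOp P W) (parityOp_mem_chains P) (fun f => (parityOp_boundary P f).symm)

/-- `H_k(n̄, W)` is a completely reducible `l`-module: every graded `l`-submodule (a subspace stable
under `l` and under the parity involution) has a complementary graded `l`-submodule. -/
def HomologyCompletelyReducible (k : ℕ) : Prop :=
  ∀ U : Submodule ℂ (Homology P W k),
    (∀ u ∈ U, homologyParity P W k u ∈ U) → (∀ A, ∀ u ∈ U, homologyAct P W k A u ∈ U) →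
    ∃ U' : Submodule ℂ (Homology P W k),
      (∀ u ∈ U', homologyParity P W k u ∈ U') ∧ (∀ A, ∀ u ∈ U', homologyAct P W k A u ∈ U') ∧
      IsCompl U U'

end Operators

/-! ### Invariant forms and the coboundary operator -/

/-- A normalisation of the Killing form: a non-degenerate supersymmetric consistent invariant
bilinear form. -/
structure IsKillingForm (B : g →ₗ[ℂ] g →ₗ[ℂ] ℂ) : Prop where
  nondegenerate : ∀ x, (∀ y, B x y = 0) → x = 0
  supersymmetric : ∀ {i j : ZMod 2} {x y : g}, x ∈ gr (V := g) i → y ∈ gr (V := g) j →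
    B x y = koszul i j * B y x
  consistent : ∀ x ∈ gr (V := g) 0, ∀ y ∈ gr (V := g) 1, B x y = 0
  invariant : ∀ x y z, B (br x y) z = B x (br y z)

theorem IsKillingForm.eq_zero {B : g →ₗ[ℂ] g →ₗ[ℂ] ℂ} (hB : IsKillingForm B) {i j : ZMod 2}
    (hij : i ≠ j) {x y : g} (hx : x ∈ gr (V := g) i) (hy : y ∈ gr (V := g) j) : B x y = 0 := by
  rcases zmod_two i with rfl | rfl <;> rcases zmod_two j with rfl | rfl
  · exact absurd rfl hij
  · exact hB.consistent x hx y hy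
  · rw [hB.supersymmetric hx hy, hB.consistent y hy x hx, mul_zero]
  · exact absurd rfl hij

/-- `ξ` is a homogeneous basis of `n`, with parities `|ξ_a| = par a`, and `ξd` is the dual basis
`ξ_a^‡` of `n̄`, in the sense that `(ξ_a^‡, ξ_b) = δ_{ab}`. -/
structure IsDualBasis (P : Parabolic g) (B : g →ₗ[ℂ] g →ₗ[ℂ] ℂ) {ι : Type*} [DecidableEq ι]
    (par : ι → ZMod 2) (ξ : Module.Basis ι ℂ P.n) (ξd : Module.Basis ι ℂ P.nbar) : Prop where
  homogeneous : ∀ a, (ξ a : g) ∈ gr (V := g) (par a)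
  dual : ∀ a b, B (ξd a : g) (ξ b : g) = if a = b then 1 else 0

section Coboundary

variable {P : Parabolic g} {B : g →ₗ[ℂ] g →ₗ[ℂ] ℂ} {ι : Type*} [Fintype ι] [DecidableEq ι]
  {par : ι → ZMod 2} {ξ : Module.Basis ι ℂ P.n} {ξd : Module.Basis ι ℂ P.nbar}

theorem IsDualBasis.homogeneous_dual (hB : IsKillingForm B) (h : IsDualBasis P B par ξ ξd) (a : ι) :
    (ξd a : g) ∈ gr (V := g) (par a) := by
  have key : (⟨proj (par a) (ξd a : g), P.isGraded_nbar _ (ξd a).2 _⟩ : P.nbar) = ξd a := by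
    apply ξd.repr.injective
    ext b
    have hc : ∀ z : P.nbar, ξd.repr z b = B (z : g) (ξ b : g) := by
      intro z
      have hz : (z : g) = ∑ a, ξd.repr z a • (ξd a : g) := by
        conv_lhs => rw [← ξd.sum_repr z]
        simp only [Submodule.coe_sum, Submodule.coe_smul]
      rw [hz]
      simp only [map_sum, LinearMap.sum_apply, map_smul, LinearMap.smul_apply, h.dual, smul_eq_mul,
        mul_ite, mul_one, mul_zero, Finset.sum_ite_eq', Finset.mem_univ, if_true]
    rw [hc, hc]
    by_cases hab : par a = par b
    · obtain ⟨c, hc', hx⟩ : ∃ c, c ≠ par a ∧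
          (ξd a : g) = proj (par a) (ξd a : g) + proj c (ξd a : g) := by
        rcases zmod_two (par a) with h0 | h0 <;> rw [h0]
        · exact ⟨1, by decide, (proj_add _).symm⟩
        · exact ⟨0, by decide, by rw [add_comm]; exact (proj_add _).symm⟩
      conv_rhs => rw [hx]
      rw [map_add, LinearMap.add_apply,
        hB.eq_zero (hab ▸ hc') (proj_mem c _) (h.homogeneous b), add_zero]
    · rw [hB.eq_zero hab (proj_mem _ _) (h.homogeneous b), h.dual, if_neg]
      rintro rfl
      exact hab rfl
  have := proj_mem (par a) (ξd a : g)
  rwa [show proj (par a) (ξd a : g) = ξd a from congrArg Subtype.val key] at this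

variable (par ξ ξd) in
/-- `Y ↦ ½ ∑_a (-1)^{|ξ_a|} ξ_a^‡ ∧ [ξ_a, Y]_{n̄}`. -/
def cobracket : P.nbar →ₗ[ℂ] SuperExt P.nbar :=
  (1 / 2 : ℂ) • ∑ a, koszul (par a) (par a) •
    (LinearMap.mulLeft ℂ (ext P.nbar (ξd a)) ∘ₗ ext P.nbar ∘ₗ adN P (ξ a : g))

theorem cobracket_mul (hB : IsKillingForm B) (h : IsDualBasis P B par ξ ξd) {i j : ZMod 2}
    {X Y : P.nbar} (hX : (X : g) ∈ gr (V := g) i) (hY : (Y : g) ∈ gr (V := g) j) :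
    cobracket par ξ ξd X * ext _ Y = koszul i j • (ext _ Y * cobracket par ξ ξd X) := by
  simp only [cobracket, LinearMap.smul_apply, LinearMap.sum_apply, LinearMap.comp_apply,
    LinearMap.mulLeft_apply, smul_mul_assoc, mul_smul_comm, Finset.sum_mul, Finset.mul_sum,
    Finset.smul_sum]
  refine Finset.sum_congr rfl fun a _ => ?_
  have h1 := ext_mul_ext (adN_mem P (h.homogeneous a) hX) hY
  have h2 := ext_mul_ext (h.homogeneous_dual hB a) hY
  have h3 : ext P.nbar (ξd a) * ext P.nbar (adN P (ξ a : g) X) * ext P.nbar Y =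
      koszul i j • (ext P.nbar Y * (ext P.nbar (ξd a) * ext P.nbar (adN P (ξ a : g) X))) := by
    rw [mul_assoc, h1, mul_neg, mul_smul_comm, ← mul_assoc, h2, neg_mul, smul_neg, neg_neg,
      smul_mul_assoc, smul_smul, koszul_add_left, mul_assoc, mul_comm (koszul (par a) j), mul_assoc,
      koszul_sq, mul_one, mul_assoc]
  rw [h3]
  simp only [smul_smul]
  congr 1
  ring

variable (W : Type*) [AddCommGroup W] [Module ℂ W] [SuperSpace W] [LieSupermodule g W]

/-- The coboundary operator `δ` is given by `δ w = ∑_a (-1)^{|ξ_a|} ξ_a^‡ ⊗ ξ_a w` and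
`δ(Y ∧ f) = ½ ∑_a (-1)^{|ξ_a|} ξ_a^‡ ∧ [ξ_a, Y]_{n̄} ∧ f - Y ∧ δ f`. -/
def coboundaryData (hB : IsKillingForm B) (h : IsDualBasis P B par ξ ξd) : RecData P.nbar W where
  s := -LinearMap.id
  P := wedgeL P.nbar W ∘ₗ cobracket par ξ ξd
  D₀ := ∑ a, koszul (par a) (par a) •
    (tmul P.nbar W (ext _ (ξd a)) ∘ₗ LieSupermodule.smul (ξ a : g))
  s_mem _ _ hY := Submodule.neg_mem _ hY
  rel i j X Y hX hY f := by
    change wedge (cobracket par ξ ξd X) (wedge (ext _ Y) f) +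
        wedge (ext _ (-X)) (wedge (cobracket par ξ ξd Y) f) =
      -(koszul i j • (wedge (cobracket par ξ ξd Y) (wedge (ext _ X) f) +
        wedge (ext _ (-Y)) (wedge (cobracket par ξ ξd X) f)))
    have h1 := cobracket_mul hB h hX hY
    have h2 := cobracket_mul hB h hY hX
    rw [← wedge_mul, ← wedge_mul, ← wedge_mul, ← wedge_mul, h1, h2, koszul_comm j i]
    simp only [map_neg, neg_mul, wedge_neg, wedge_smul]
    have e1 := koszul_sq i j
    match_scalars
    all_goals first | linear_combination e1 | linear_combination -e1 | ring

/-- The coboundary operator `δ`. -/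
def coboundary (hB : IsKillingForm B) (h : IsDualBasis P B par ξ ξd) :
    Module.End ℂ (Chains P.nbar W) :=
  (coboundaryData W hB h).op

theorem coboundary_one (hB : IsKillingForm B) (h : IsDualBasis P B par ξ ξd) (w : W) :
    coboundary W hB h (tmul _ W 1 w) = ∑ a, koszul (par a) (par a) •
      tmul _ W (ext _ (ξd a)) (LieSupermodule.smul (ξ a : g) w) := by
  refine (RecData.op_one _ w).trans ?_
  simp [coboundaryData]

theorem coboundary_wedge (hB : IsKillingForm B) (h : IsDualBasis P B par ξ ξd) (Y : P.nbar)
    (f : Chains P.nbar W) :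
    coboundary W hB h (wedge (ext _ Y) f) =
      (1 / 2 : ℂ) • ∑ a, koszul (par a) (par a) •
        wedge (ext _ (ξd a)) (wedge (ext _ (adN P (ξ a : g) Y)) f) -
      wedge (ext _ Y) (coboundary W hB h f) := by
  refine (RecData.op_wedge _ Y f).trans ?_
  change wedgeL P.nbar W (cobracket par ξ ξd Y) f + wedge (ext _ (-Y)) (coboundary W hB h f) = _
  rw [map_neg, wedge_neg, ← sub_eq_add_neg]
  congr 1
  simp only [cobracket, LinearMap.smul_apply, LinearMap.sum_apply, map_smul, map_sum,
    LinearMap.comp_apply, LinearMap.mulLeft_apply]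
  simp only [← wedge_mul]
  rfl

end Coboundary

/-- Two operators `S`, `T` are disjoint if `S (T f) = 0` implies `T f = 0` and `T (S f) = 0` implies
`S f = 0`. -/
def DisjointOperators {C : Type*} [AddCommGroup C] [Module ℂ C] (S T : Module.End ℂ C) : Prop :=
  (∀ f, S (T f) = 0 → T f = 0) ∧ (∀ f, T (S f) = 0 → S f = 0)

/-! ### Basic classical Lie superalgebras of type I -/

variable (g) in
/-- `g` is simple: it is not abelian and has no proper non-zero graded ideals. -/
def IsSimple : Prop :=
  (∃ x y : g, br x y ≠ 0) ∧
  ∀ I : Submodule ℂ g, IsGraded I → (∀ x, ∀ y ∈ I, br x y ∈ I) → I = ⊥ ∨ I = ⊤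

/-- `U` is a submodule of `g`, viewed as a module of the even part `g_0`. -/
def EvenStable (U : Submodule ℂ g) : Prop := ∀ x ∈ gr (V := g) 0, ∀ u ∈ U, br x u ∈ U

/-- `U` is an irreducible `g_0`-submodule of `g`. -/
def EvenIrreducible (U : Submodule ℂ g) : Prop :=
  EvenStable U ∧ U ≠ ⊥ ∧ ∀ U' ≤ U, EvenStable U' → U' = ⊥ ∨ U' = U

variable (g) in
/-- A basic classical Lie superalgebra: a simple finite dimensional Lie superalgebra for which `g_1`
is a completely reducible `g_0`-module, and which admits a non-degenerate supersymmetric consistent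
invariant bilinear form. -/
structure IsBasicClassical : Prop where
  finiteDimensional : FiniteDimensional ℂ g
  simple : IsSimple g
  classical : ∀ U ≤ gr (V := g) 1, EvenStable U →
    ∃ U' ≤ gr (V := g) 1, EvenStable U' ∧ U ⊓ U' = ⊥ ∧ U ⊔ U' = gr (V := g) 1
  basic : ∃ B : g →ₗ[ℂ] g →ₗ[ℂ] ℂ, IsKillingForm B

variable (g) in
/-- `g` is of type I: the `g_0`-module `g_1` is the direct sum of two irreducible submodules. -/
def IsTypeI : Prop :=
  ∃ U U' : Submodule ℂ g, EvenIrreducible U ∧ EvenIrreducible U' ∧ U ⊓ U' = ⊥ ∧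
    U ⊔ U' = gr (V := g) 1

/-! ### Adjoint operations and star representations -/

/-- An adjoint operation on `g`: an antilinear even map with `[A, B]^† = [B^†, A^†]` and
`A^†^† = A`. -/
structure IsAdjointOperation (dag : g →ₛₗ[starRingEnd ℂ] g) : Prop where
  even : ∀ (i : ZMod 2), ∀ x ∈ gr (V := g) i, dag x ∈ gr (V := g) i
  br : ∀ x y : g, dag (br x y) = br (dag y) (dag x)
  involutive : ∀ x, dag (dag x) = x

/-- `W` is a star representation for `†`: it has a positive definite hermitian inner product
(antilinear in the first argument) with `⟨A v, w⟩ = ⟨v, A^† w⟩`. -/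
def IsStarRepresentation (W : Type*) [AddCommGroup W] [Module ℂ W] [SuperSpace W]
    [LieSupermodule g W] (dag : g →ₛₗ[starRingEnd ℂ] g) : Prop :=
  ∃ h : W →ₛₗ[starRingEnd ℂ] W →ₗ[ℂ] ℂ,
    (∀ v w, h w v = starRingEnd ℂ (h v w)) ∧
    (∀ v, v ≠ 0 → 0 < (h v v).re) ∧
    ∀ (A : g) (v w : W), h (LieSupermodule.smul A v) w = h v (LieSupermodule.smul (dag A) w)

variable (g) in
/-- `W` is an irreducible `g`-module: non-zero, without proper non-zero graded submodules. -/
def IsIrreducible (W : Type*) [AddCommGroup W] [Module ℂ W] [SuperSpace W]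
    [LieSupermodule g W] : Prop :=
  (∃ w : W, w ≠ 0) ∧ ∀ U : Submodule ℂ W, IsGraded U →
    (∀ A : g, ∀ u ∈ U, LieSupermodule.smul A u ∈ U) → U = ⊥ ∨ U = ⊤

end Lie

end KostantSuper

end

noncomputable section

namespace KostantSuper

open SuperSpace LieSuperalgebra
open scoped ComplexConjugate

/-! The proof is Hodge theory on Λ n̄ ⊗ W. The inner product of W extends to a hermitian form on
chains for which the ξ_a^‡ are orthonormal and left multiplication by ξ_a^‡ is adjoint to the
contraction ι_a with ξ_a. On odd generators, where Λ n̄ is a polynomial algebra, this is the Fock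
inner product. `chainForm` builds it one degree at a time through contractions. It is positive
definite on k-chains, because a chain of positive degree killed by every ι_a vanishes by Euler's
identity (`sum_wedge_contract`, `eq_zero_of_chainForm_self`).

Two adjunctions carry the theorem. First, A[·] is adjoint to A^†[·] (`chainForm_act`). On n̄ this
says that the matrices of A and A^† in the basis ξ_a^‡ are conjugate transposes
(`IsDualBasis.conj_structure`), and the sign in ξ_a^† = (-1)^{|ξ_a|} ξ_a^‡ is what makes it hold for
odd A. Second, δ^* is adjoint to -δ (`chainForm_boundary`), by induction from the recursion for δ^*
and Cartan's formula ι_b δ + δ ι_b = (-1)^{|ξ_b|} ξ_b[·] (`contract_coboundary`).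

Disjointness follows from ⟨δ^*f, δ^*f⟩ = -⟨f, δδ^*f⟩ and its counterpart for δ. For complete
reducibility, † preserves l (`IsDualBasis.dag_levi`), so inside the finite-dimensional space of
k-cycles the orthogonal complement of an l-submodule is an l-submodule. Applied to the preimage of a
submodule of homology, this gives a complement there after projection. Complements are graded
because the inner product of W can be averaged over the parity involution.

The Lie-theoretic input is that the form pairs degree k of the grading only with degree -k, and that
† is compatible with the form. Both follow from uniqueness, up to a scalar, of invariant even forms
on a simple Lie superalgebra (`IsKillingForm.exists_eq_smul`). -/

theorem conj_koszul (i j : ZMod 2) : conj (koszul i j) = koszul i j := by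
  unfold koszul; split_ifs <;> simp

/-! ### Invariant forms on a simple Lie superalgebra -/

section InvariantForms

variable {g : Type*} [AddCommGroup g] [Module ℂ g] [LieSuperalgebra g]

theorem IsKillingForm.proj_left {B : g →ₗ[ℂ] g →ₗ[ℂ] ℂ} (hB : IsKillingForm B) (i : ZMod 2)
    (x y : g) : B (proj i x) y = B x (proj i y) := by
  have h01 := hB.eq_zero (show (0 : ZMod 2) ≠ 1 by decide) (proj_mem 0 x) (proj_mem 1 y)
  have h10 := hB.eq_zero (show (1 : ZMod 2) ≠ 0 by decide) (proj_mem 1 x) (proj_mem 0 y)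
  conv_lhs => rw [← proj_add y]
  conv_rhs => rw [← proj_add x]
  rcases zmod_two i with rfl | rfl <;> simp [h01, h10]

/-- On a simple Lie superalgebra an invariant consistent form is a multiple of a given
non-degenerate one. -/
theorem IsKillingForm.exists_eq_smul [FiniteDimensional ℂ g] (hg : IsSimple g)
    {B : g →ₗ[ℂ] g →ₗ[ℂ] ℂ} (hB : IsKillingForm B) (B' : g →ₗ[ℂ] g →ₗ[ℂ] ℂ)
    (heven : ∀ i x y, B' (proj i x) y = B' x (proj i y))
    (hinv : ∀ x y z, B' (br x y) z = B' x (br y z)) : ∃ c : ℂ, ∀ x y, B' x y = c * B x y := by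
  have hinj : Function.Injective B := by
    rw [← LinearMap.ker_eq_bot, LinearMap.ker_eq_bot']
    exact fun x hx => hB.nondegenerate x fun y => by rw [hx]; rfl
  have hext : ∀ {x y : g}, (∀ z, B x z = B y z) → x = y := fun h => hinj (LinearMap.ext h)
  let e : g ≃ₗ[ℂ] Module.Dual ℂ g :=
    LinearEquiv.ofInjectiveOfFinrankEq B hinj (Subspace.dual_finrank_eq).symm
  -- Schur's lemma: φ is the endomorphism with B (φ x) y = B' x y. It is even and commutes with
  -- right brackets, so each of its eigenspaces is a graded ideal.
  let φ : Module.End ℂ g := e.symm.toLinearMap ∘ₗ B'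
  have hφ : ∀ x y, B (φ x) y = B' x y := fun x y =>
    LinearMap.congr_fun (e.apply_symm_apply (B' x)) y
  have hφbr : ∀ x y, φ (br x y) = br (φ x) y := fun x y => hext fun z => by
    rw [hφ, hinv, hB.invariant, hφ]
  have hφproj : ∀ i x, φ (proj i x) = proj i (φ x) := fun i x => hext fun z => by
    rw [hφ, heven, hB.proj_left, hφ]
  obtain ⟨⟨x₀, y₀, hxy⟩, hid⟩ := hg
  have : Nontrivial g := ⟨⟨_, _, hxy⟩⟩
  obtain ⟨c, hc⟩ := Module.End.exists_eigenvalue φ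
  have hgr : IsGraded (φ.eigenspace c) := fun x hx i => by
    rw [Module.End.mem_eigenspace_iff] at hx ⊢
    rw [hφproj, hx, map_smul]
  have hideal : ∀ x, ∀ y ∈ φ.eigenspace c, br x y ∈ φ.eigenspace c := by
    intro x y hy
    have key : ∀ i j, br (proj i x) (proj j y) ∈ φ.eigenspace c := by
      intro i j
      -- Only right brackets commute with φ directly; skew-symmetry, available for homogeneous
      -- elements, transfers this to left brackets.
      have hj := hgr y hy j
      rw [Module.End.mem_eigenspace_iff] at hj ⊢
      rw [br_skew (proj_mem i x) (proj_mem j y), map_neg, map_smul, hφbr, hj, map_smul,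
        LinearMap.smul_apply, smul_neg, smul_comm]
    rw [← proj_add x, ← proj_add y]
    simp only [map_add, LinearMap.add_apply]
    exact add_mem (add_mem (key _ _) (key _ _)) (add_mem (key _ _) (key _ _))
  have htop : φ.eigenspace c = ⊤ := (hid _ hgr hideal).resolve_left hc
  refine ⟨c, fun x y => ?_⟩
  have hx : x ∈ φ.eigenspace c := htop ▸ Submodule.mem_top
  rw [← hφ, Module.End.mem_eigenspace_iff.1 hx, map_smul, LinearMap.smul_apply, smul_eq_mul]

/-! ### The degree derivation of a parabolic decomposition -/

namespace Parabolic

variable (P : Parabolic g)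

/-- The derivation of `g` that is multiplication by `k` in degree `k`. -/
def degree : Module.End ℂ g :=
  DirectSum.toModule ℂ ℤ g (fun k => (k : ℂ) • (P.deg k).subtype) ∘ₗ
    (LinearEquiv.ofBijective (DirectSum.coeLinearMap P.deg) P.isInternal).symm.toLinearMap

variable {P}

theorem degree_of_mem {k : ℤ} {x : g} (hx : x ∈ P.deg k) : P.degree x = (k : ℂ) • x := by
  have h : (LinearEquiv.ofBijective (DirectSum.coeLinearMap P.deg) P.isInternal).symm x =
      DirectSum.lof ℂ ℤ (fun k => P.deg k) k ⟨x, hx⟩ := by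
    rw [LinearEquiv.symm_apply_eq]
    exact (DirectSum.coeLinearMap_lof P.deg k ⟨x, hx⟩).symm
  simp only [degree, LinearMap.comp_apply, LinearEquiv.coe_coe, h, DirectSum.toModule_lof]
  rfl

theorem deg_induction {p : g → Prop} (x : g) (hmem : ∀ k, ∀ x ∈ P.deg k, p x) (h0 : p 0)
    (hadd : ∀ x y, p x → p y → p (x + y)) : p x :=
  Submodule.iSup_induction P.deg (motive := p)
    (P.isInternal.submodule_iSup_eq_top ▸ Submodule.mem_top : x ∈ ⨆ k, P.deg k) hmem h0 hadd

theorem degree_br (x y : g) : P.degree (br x y) = br (P.degree x) y + br x (P.degree y) := by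
  induction x using P.deg_induction with
  | h0 => simp
  | hadd x x' hx hx' => simp only [map_add, LinearMap.add_apply, hx, hx']; abel
  | hmem k x hx =>
    induction y using P.deg_induction with
    | h0 => simp
    | hadd y y' hy hy' => simp only [map_add, hy, hy']; abel
    | hmem l y hy =>
      rw [degree_of_mem hx, degree_of_mem hy, degree_of_mem (P.br_mem_deg hx hy), map_smul,
        map_smul, LinearMap.smul_apply, ← add_smul, Int.cast_add]

theorem degree_proj (i : ZMod 2) (x : g) : P.degree (proj i x) = proj i (P.degree x) := by
  induction x using P.deg_induction with
  | h0 => simp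
  | hadd x x' hx hx' => simp only [map_add, hx, hx']
  | hmem k x hx => rw [degree_of_mem (P.isGraded k x hx i), degree_of_mem hx, map_smul]

/-- If l = 0 then the Cartan subalgebra inside it is 0 and its normaliser in the even part is the
whole even part, which is therefore 0. Then g is purely odd, all brackets vanish, and g is abelian.
A non-zero element of l is needed to fix the scalar in `IsDualBasis.deg_orthogonal`. -/
theorem levi_ne_bot (hg : IsSimple g) : P.levi ≠ ⊥ := by
  intro hl
  obtain ⟨h, hh, hle⟩ := P.exists_cartan
  have h0 : ∀ y ∈ h, y = 0 := fun y hy => (Submodule.mem_bot ℂ).1 (hl ▸ hle hy)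
  have he : ∀ x ∈ gr (V := g) 0, x = 0 := fun x hx =>
    h0 x (hh.self_normalizing x hx fun y hy => by rw [h0 y hy, map_zero]; exact h.zero_mem)
  have h1 : ∀ x : g, x ∈ gr (V := g) 1 := fun x => by
    rw [← proj_add x, he _ (proj_mem 0 x), zero_add]
    exact proj_mem 1 x
  obtain ⟨⟨x, y, hxy⟩, -⟩ := hg
  have h2 := br_mem (h1 x) (h1 y)
  rw [show (1 + 1 : ZMod 2) = 0 by decide] at h2
  exact hxy (he _ h2)

theorem le_n {k : ℤ} (hk : 0 < k) : P.deg k ≤ P.n :=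
  le_iSup (fun k : {k : ℤ // 0 < k} => P.deg k) ⟨k, hk⟩

theorem le_nbar {k : ℤ} (hk : k < 0) : P.deg k ≤ P.nbar :=
  le_iSup (fun k : {k : ℤ // k < 0} => P.deg k) ⟨k, hk⟩

theorem mem_sum (x : g) : ∃ y ∈ P.nbar, ∃ z ∈ P.levi, ∃ w ∈ P.n, x = y + (z + w) := by
  obtain ⟨y, hy, b, hb, rfl⟩ := Submodule.mem_sup.1
    (P.isCompl.codisjoint.eq_top ▸ Submodule.mem_top : x ∈ P.nbar ⊔ P.p)
  obtain ⟨z, hz, w, hw, rfl⟩ := Submodule.mem_sup.1 hb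
  exact ⟨y, hy, z, hz, w, hw, rfl⟩

end Parabolic

/-! ### Orthogonality and the adjoint operation relative to dual bases -/

section DualBasis

variable {P : Parabolic g} {B : g →ₗ[ℂ] g →ₗ[ℂ] ℂ} {ι : Type*} [Fintype ι] [DecidableEq ι]
  {par : ι → ZMod 2} {ξ : Module.Basis ι ℂ P.n} {ξd : Module.Basis ι ℂ P.nbar}

theorem IsDualBasis.repr_nbar (h : IsDualBasis P B par ξ ξd) (Y : P.nbar) (b : ι) :
    ξd.repr Y b = B (Y : g) (ξ b : g) := by
  have hz : (Y : g) = ∑ a, ξd.repr Y a • (ξd a : g) := by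
    conv_lhs => rw [← ξd.sum_repr Y]
    simp only [Submodule.coe_sum, Submodule.coe_smul]
  rw [hz]
  simp [h.dual]

theorem IsDualBasis.repr_n (h : IsDualBasis P B par ξ ξd) (X : P.n) (b : ι) :
    ξ.repr X b = B (ξd b : g) (X : g) := by
  have hz : (X : g) = ∑ a, ξ.repr X a • (ξ a : g) := by
    conv_lhs => rw [← ξ.sum_repr X]
    simp only [Submodule.coe_sum, Submodule.coe_smul]
  rw [hz]
  simp [h.dual]

theorem IsDualBasis.eq_zero_nbar (h : IsDualBasis P B par ξ ξd) {y : g} (hy : y ∈ P.nbar)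
    (h0 : ∀ x ∈ P.n, B y x = 0) : y = 0 := by
  have : (⟨y, hy⟩ : P.nbar) = 0 := ξd.ext_elem fun b => by
    rw [h.repr_nbar, h0 _ (ξ b).2, map_zero, Finsupp.zero_apply]
  exact congrArg Subtype.val this

theorem IsDualBasis.eq_zero_n (h : IsDualBasis P B par ξ ξd) {x : g} (hx : x ∈ P.n)
    (h0 : ∀ y ∈ P.nbar, B y x = 0) : x = 0 := by
  have : (⟨x, hx⟩ : P.n) = 0 := ξ.ext_elem fun b => by
    rw [h.repr_n, h0 _ (ξd b).2, map_zero, Finsupp.zero_apply]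
  exact congrArg Subtype.val this

/-- The form pairs the part of degree `k` with the part of degree `-k`. -/
theorem IsDualBasis.deg_orthogonal [FiniteDimensional ℂ g] (hg : IsSimple g)
    (hB : IsKillingForm B) (h : IsDualBasis P B par ξ ξd) {k l : ℤ} (hkl : k + l ≠ 0) {x y : g}
    (hx : x ∈ P.deg k) (hy : y ∈ P.deg l) : B x y = 0 := by
  -- Since the degree operator D is an even derivation, (Dx, y) + (x, Dy) is again invariant and
  -- even, hence equal to m (x, y). So degrees k and l can pair non-trivially only if k + l = m.
  obtain ⟨m, hm⟩ := hB.exists_eq_smul hg (B ∘ₗ P.degree + LinearMap.compl₂ B P.degree)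
    (fun i x y => by simp [Parabolic.degree_proj, hB.proj_left])
    (fun x y z => by
      simp only [LinearMap.add_apply, LinearMap.comp_apply, LinearMap.compl₂_apply,
        Parabolic.degree_br, map_add, hB.invariant, add_assoc])
  have hdeg : ∀ {k l : ℤ} {x y : g}, x ∈ P.deg k → y ∈ P.deg l → B x y ≠ 0 →
      ((k + l : ℤ) : ℂ) = m := by
    intro k l x y hx hy hxy
    have := hm x y
    simp only [LinearMap.add_apply, LinearMap.comp_apply, LinearMap.compl₂_apply,
      Parabolic.degree_of_mem hx, Parabolic.degree_of_mem hy, map_smul, LinearMap.smul_apply,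
      smul_eq_mul, ← add_mul] at this
    push_cast
    exact mul_right_cancel₀ hxy this
  -- A non-zero z in l pairs with some w of degree k, so m = k. If k ≠ 0, then w lies in n or n̄ and
  -- pairs, through the dual bases, with an element of non-zero degree j in the opposite one; k + j
  -- = m = k is then a contradiction.
  suffices hm0 : m = 0 by
    by_contra hxy
    exact hkl (by exact_mod_cast (hdeg hx hy hxy).trans hm0)
  obtain ⟨z, hz, hz0⟩ := Submodule.exists_mem_ne_zero_of_ne_bot (Parabolic.levi_ne_bot (P := P) hg)
  obtain ⟨k, w, hw, hzw⟩ : ∃ k, ∃ w ∈ P.deg k, B z w ≠ 0 := by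
    by_contra! hcon
    exact hz0 (hB.nondegenerate z fun y => by
      induction y using P.deg_induction with
      | h0 => simp
      | hadd y y' hy hy' => rw [map_add, hy, hy', add_zero]
      | hmem k y hy => exact hcon k y hy)
  have hk := hdeg hz hw hzw
  rw [zero_add] at hk
  have hw0 : w ≠ 0 := by rintro rfl; simp at hzw
  rcases lt_trichotomy k 0 with hk0 | rfl | hk0
  · exfalso
    refine hw0 (h.eq_zero_nbar (Parabolic.le_nbar hk0 hw) fun x hx => ?_)
    induction hx using Submodule.iSup_induction' with
    | zero => simp
    | add x x' _ _ hx hx' => rw [map_add, hx, hx', add_zero]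
    | mem j x hx =>
      by_contra hne
      have := (hdeg hw hx hne).trans hk.symm
      have : k + j = k := by exact_mod_cast this
      have := j.2
      omega
  · rw [← hk, Int.cast_zero]
  · exfalso
    refine hw0 (h.eq_zero_n (Parabolic.le_n hk0 hw) fun x hx => ?_)
    induction hx using Submodule.iSup_induction' with
    | zero => simp
    | add x x' _ _ hx hx' => rw [map_add, LinearMap.add_apply, hx, hx', add_zero]
    | mem j x hx =>
      by_contra hne
      have := (hdeg hx hw hne).trans hk.symm
      have : j + k = k := by exact_mod_cast this
      have := j.2
      omega

variable [FiniteDimensional ℂ g] (hg : IsSimple g) (hB : IsKillingForm B)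
  (h : IsDualBasis P B par ξ ξd)

include hg hB h

theorem IsDualBasis.levi_n {z x : g} (hz : z ∈ P.levi) (hx : x ∈ P.n) : B z x = 0 := by
  induction hx using Submodule.iSup_induction' with
  | zero => simp
  | add x x' _ _ hx hx' => rw [map_add, hx, hx', add_zero]
  | mem j x hx => exact h.deg_orthogonal hg hB (by have := j.2; omega) hz hx

theorem IsDualBasis.nbar_levi {z y : g} (hz : z ∈ P.levi) (hy : y ∈ P.nbar) : B y z = 0 := by
  induction hy using Submodule.iSup_induction' with
  | zero => simp
  | add x x' _ _ hx hx' => rw [map_add, LinearMap.add_apply, hx, hx', add_zero]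
  | mem j x hx => exact h.deg_orthogonal hg hB (by have := j.2; omega) hx hz

theorem IsDualBasis.nbar_nbar {y z : g} (hy : y ∈ P.nbar) (hz : z ∈ P.nbar) : B y z = 0 := by
  induction hy using Submodule.iSup_induction' with
  | zero => simp
  | add x x' _ _ hx hx' => rw [map_add, LinearMap.add_apply, hx, hx', add_zero]
  | mem j x hx =>
    induction hz using Submodule.iSup_induction' with
    | zero => simp
    | add x x' _ _ hx hx' => rw [map_add, hx, hx', add_zero]
    | mem l z hz => exact h.deg_orthogonal hg hB (by have := j.2; have := l.2; omega) hx hz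

theorem IsDualBasis.n_n {y z : g} (hy : y ∈ P.n) (hz : z ∈ P.n) : B y z = 0 := by
  induction hy using Submodule.iSup_induction' with
  | zero => simp
  | add x x' _ _ hx hx' => rw [map_add, LinearMap.add_apply, hx, hx', add_zero]
  | mem j x hx =>
    induction hz using Submodule.iSup_induction' with
    | zero => simp
    | add x x' _ _ hx hx' => rw [map_add, hx, hx', add_zero]
    | mem l z hz => exact h.deg_orthogonal hg hB (by have := j.2; have := l.2; omega) hx hz

/-- The part of x in p = l + n is orthogonal to n and does not contribute. The projection in [A,
Y]_{n̄} thus disappears from all coordinate computations. -/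
theorem IsDualBasis.repr_toNbar (x : g) (b : ι) : ξd.repr (P.toNbar x) b = B x (ξ b : g) := by
  obtain ⟨y, hy, z, hz, w, hw, rfl⟩ := P.mem_sum x
  have hp : P.toNbar (z + w) = 0 := (Submodule.projectionOnto_apply_eq_zero_iff P.isCompl).2
    (Submodule.add_mem_sup hz hw)
  rw [map_add, hp, add_zero, h.repr_nbar, P.toNbar_of_mem hy, map_add, map_add,
    LinearMap.add_apply, LinearMap.add_apply, h.levi_n hg hB hz (ξ b).2,
    h.n_n hg hB hw (ξ b).2, add_zero, add_zero]

omit h in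
/-- The form is hermitian with respect to an adjoint operation, up to a scalar. -/
theorem IsAdjointOperation.exists_conj_form {dag : g →ₛₗ[starRingEnd ℂ] g}
    (hdag : IsAdjointOperation dag) :
    ∃ c : ℂ, ∀ x y, conj (B (dag y) (dag x)) = c * B x y := by
  have hproj : ∀ i x, dag (proj i x) = proj i (dag x) := by
    intro i x
    conv_rhs => rw [← proj_add x]
    rw [map_add, map_add, proj_of_mem (hdag.even 0 _ (proj_mem 0 x)),
      proj_of_mem (hdag.even 1 _ (proj_mem 1 x))]
    rcases zmod_two i with rfl | rfl <;> simp
  -- Conjugating the value makes the form bilinear, and exchanging the arguments compensates for †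
  -- reversing brackets.
  obtain ⟨c, hc⟩ := hB.exists_eq_smul hg (LinearMap.mk₂ ℂ (fun x y => conj (B (dag y) (dag x)))
    (by intros; simp) (by intros; simp) (by intros; simp) (by intros; simp))
    (fun i x y => by
      rw [LinearMap.mk₂_apply, LinearMap.mk₂_apply, hproj, hproj, hB.proj_left])
    (fun x y z => by
      rw [LinearMap.mk₂_apply, LinearMap.mk₂_apply, hdag.br, hdag.br, hB.invariant])
  exact ⟨c, hc⟩

variable {dag : g →ₛₗ[starRingEnd ℂ] g} (hdag : IsAdjointOperation dag)
  (hdual : ∀ a, dag (ξ a : g) = koszul (par a) (par a) • (ξd a : g))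

omit [Fintype ι] [DecidableEq ι] [FiniteDimensional ℂ g] hg hB h in
include hdag hdual in
theorem IsAdjointOperation.dag_dual (a : ι) :
    dag (ξd a : g) = koszul (par a) (par a) • (ξ a : g) := by
  have h1 := congrArg dag (hdual a)
  rw [hdag.involutive, LinearMap.map_smulₛₗ, conj_koszul] at h1
  rw [h1, smul_smul, koszul_sq, one_smul]

include hdag hdual

omit [Fintype ι] in
-- The scalar of `IsAdjointOperation.exists_conj_form` is read off from the pair ξ_a^‡, ξ_a: †
-- exchanges them up to the same sign, which occurs twice, so the scalar is 1. The index `a` is an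
-- argument because this normalisation requires n ≠ 0.
theorem IsDualBasis.conj_form (a : ι) (x y : g) : conj (B x y) = B (dag y) (dag x) := by
  obtain ⟨c, hc⟩ := hdag.exists_conj_form hg hB
  have h1 := hc (ξd a) (ξ a)
  rw [h.dual, if_pos rfl, mul_one, hdual, hdag.dag_dual hdual, LinearMap.map_smul, LinearMap.map_smul,
    LinearMap.smul_apply, smul_smul, koszul_sq, one_smul, h.dual, if_pos rfl, map_one] at h1
  have := congrArg conj (hc x y)
  rw [← h1, one_mul, Complex.conj_conj] at this
  exact this.symm

omit [DecidableEq ι] [FiniteDimensional ℂ g] hg hB h in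
theorem IsAdjointOperation.dag_nbar {y : g} (hy : y ∈ P.nbar) : dag y ∈ P.n := by
  have hz : y = ∑ a, ξd.repr ⟨y, hy⟩ a • (ξd a : g) := by
    conv_lhs => rw [show y = ((⟨y, hy⟩ : P.nbar) : g) from rfl, ← ξd.sum_repr ⟨y, hy⟩]
    simp only [Submodule.coe_sum, Submodule.coe_smul]
  rw [hz, map_sum]
  refine Submodule.sum_mem _ fun a _ => ?_
  rw [LinearMap.map_smulₛₗ, hdag.dag_dual hdual]
  exact Submodule.smul_mem _ _ (Submodule.smul_mem _ _ (ξ a).2)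

omit [DecidableEq ι] [FiniteDimensional ℂ g] hg hB h hdag in
theorem IsAdjointOperation.dag_n {y : g} (hy : y ∈ P.n) : dag y ∈ P.nbar := by
  have hz : y = ∑ a, ξ.repr ⟨y, hy⟩ a • (ξ a : g) := by
    conv_lhs => rw [show y = ((⟨y, hy⟩ : P.n) : g) from rfl, ← ξ.sum_repr ⟨y, hy⟩]
    simp only [Submodule.coe_sum, Submodule.coe_smul]
  rw [hz, map_sum]
  refine Submodule.sum_mem _ fun a _ => ?_
  rw [LinearMap.map_smulₛₗ, hdual]
  exact Submodule.smul_mem _ _ (Submodule.smul_mem _ _ (ξd a).2)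

/-- The adjoint operation preserves the Levi subalgebra. -/
theorem IsDualBasis.dag_levi {x : g} (hx : x ∈ P.levi) : dag x ∈ P.levi := by
  obtain ⟨c, hc⟩ := hdag.exists_conj_form hg hB
  have hform : ∀ x y, B x y = 0 → B (dag y) (dag x) = 0 := fun x y hxy => by
    have := hc x y
    rwa [hxy, mul_zero, map_eq_zero] at this
  obtain ⟨y, hy, z, hz, w, hw, e⟩ := P.mem_sum (dag x)
  -- Orthogonality is preserved by † up to exchanging the arguments, and † swaps n and n̄. As x is
  -- orthogonal to both, so is `dag x`, which kills its components in n̄ and n.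
  have hy0 : y = 0 := h.eq_zero_nbar hy fun u hu => by
    have := hform (dag u) x (h.nbar_levi hg hB hx (IsAdjointOperation.dag_n hdual hu))
    rw [hdag.involutive, e, map_add, map_add, LinearMap.add_apply, LinearMap.add_apply,
      h.levi_n hg hB hz hu, h.n_n hg hB hw hu, add_zero, add_zero] at this
    exact this
  have hw0 : w = 0 := h.eq_zero_n hw fun u hu => by
    have := hform x (dag u) (h.levi_n hg hB hx (hdag.dag_nbar hdual hu))
    rw [hdag.involutive, e, map_add, map_add, h.nbar_levi hg hB hz hu,
      h.nbar_nbar hg hB hu hy, zero_add, zero_add] at this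
    exact this
  rw [e, hy0, hw0, zero_add, add_zero]
  exact hz

end DualBasis

end InvariantForms

/-! ### Projection to degree zero and induction along a basis -/

section Chains

variable {V : Type*} [AddCommGroup V] [Module ℂ V] [SuperSpace V] {N : Submodule ℂ V}
  {W : Type*} [AddCommGroup W] [Module ℂ W]

variable (N) in
/-- The augmentation `Λ N → ℂ`. -/
def SuperExt.augmentation : SuperExt N →ₐ[ℂ] ℂ :=
  SuperExt.lift (TensorAlgebra.lift ℂ (0 : N →ₗ[ℂ] ℂ)) (by
    rintro _ _ ⟨i, j, X, Y, hX, hY⟩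
    simp)

theorem SuperExt.augmentation_ext (Y : N) : SuperExt.augmentation N (ext N Y) = 0 := by
  simp [SuperExt.augmentation, ext, SuperExt.lift_mk]

variable (N W) in
/-- The projection of `Λ N ⊗ W` onto `Λ^0 N ⊗ W = W`. -/
def degZero : Chains N W →ₗ[ℂ] W :=
  Chains.lift (LinearMap.lsmul ℂ W ∘ₗ (SuperExt.augmentation N).toLinearMap)

theorem degZero_one (w : W) : degZero N W (tmul N W 1 w) = w := by
  simp [degZero, Chains.lift_tmul]

theorem degZero_wedge (Y : N) (f : Chains N W) : degZero N W (wedge (ext N Y) f) = 0 := by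
  induction f using Chains.induction with
  | h0 => simp only [map_zero]
  | ht a w => simp [wedge_tmul, degZero, Chains.lift_tmul, SuperExt.augmentation_ext]
  | hadd f g hf hg => simp only [map_add, hf, hg, add_zero]

variable {ι : Type*} (b : Module.Basis ι ℂ N)

include b

/-- Left multiplication is linear in its left factor. Inductions over chains can thus be restricted
to the ξ_a^‡, on which contraction takes the Kronecker form `contract_wedge_dual`. -/
theorem wedge_mem_of_basis {S : Submodule ℂ (Chains N W)} {f : Chains N W}
    (h : ∀ i, wedge (ext N (b i)) f ∈ S) (Y : N) : wedge (ext N Y) f ∈ S := by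
  have hle : ⊤ ≤ S.comap ((wedgeL N W).flip f ∘ₗ ext N) := by
    rw [← b.span_eq, Submodule.span_le]
    rintro _ ⟨i, rfl⟩
    exact h i
  exact hle (Submodule.mem_top : Y ∈ ⊤)

theorem eq_top_of_basis {S : Submodule ℂ (Chains N W)} (hW : ∀ w : W, tmul N W 1 w ∈ S)
    (hS : ∀ i, ∀ f ∈ S, wedge (ext N (b i)) f ∈ S) : S = ⊤ :=
  eq_top_of_wedge hW fun Y f hf => wedge_mem_of_basis b (fun i => hS i f hf) Y

theorem chains_succ_le_of_basis {k : ℕ} {S : Submodule ℂ (Chains N W)}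
    (hS : ∀ i, ∀ f ∈ chains N W k, wedge (ext N (b i)) f ∈ S) : chains N W (k + 1) ≤ S :=
  chains_succ_le fun Y f hf => wedge_mem_of_basis b (fun i => hS i f hf) Y

theorem linearMap_ext_of_basis {M : Type*} [AddCommGroup M] [Module ℂ M]
    {S T : Chains N W →ₗ[ℂ] M} (hW : ∀ w : W, S (tmul N W 1 w) = T (tmul N W 1 w))
    (hS : ∀ i f, S f = T f → S (wedge (ext N (b i)) f) = T (wedge (ext N (b i)) f)) : S = T := by
  have : LinearMap.eqLocus S T = ⊤ := eq_top_of_basis b hW fun i f hf => hS i f hf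
  exact LinearMap.ext fun f => by
    have : f ∈ LinearMap.eqLocus S T := this ▸ Submodule.mem_top
    exact this

omit b

theorem iSup_chains : ⨆ k, chains N W k = ⊤ := by
  refine eq_top_of_wedge (fun w => Submodule.mem_iSup_of_mem 0 (one_mem_chains w)) fun Y => ?_
  have : ⨆ k, chains N W k ≤ (⨆ k, chains N W k).comap (wedge (ext N Y)) :=
    iSup_le fun k f hf => Submodule.mem_iSup_of_mem (k + 1) (wedge_mem_chains Y hf)
  exact fun f hf => this hf

/-- Odd generators commute, so Λ N itself may be infinite-dimensional. Orthogonal complements are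
therefore taken in one degree at a time. -/
instance finiteDimensional_chains [FiniteDimensional ℂ N] [FiniteDimensional ℂ W] (k : ℕ) :
    FiniteDimensional ℂ (chains N W k) := by
  rw [FiniteDimensional, Module.Finite.iff_fg]
  refine Submodule.FG.map₂ _ (Submodule.FG.pow ?_ k) (Module.finite_def.1 inferInstance)
  rw [← Module.Finite.iff_fg]
  infer_instance

end Chains

/-! ### Contractions -/

section Contraction

variable {g : Type*} [AddCommGroup g] [Module ℂ g] [LieSuperalgebra g]
  {P : Parabolic g} {B : g →ₗ[ℂ] g →ₗ[ℂ] ℂ} {ι : Type*} [Fintype ι] [DecidableEq ι]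
  {par : ι → ZMod 2} {ξ : Module.Basis ι ℂ P.n} {ξd : Module.Basis ι ℂ P.nbar}
  (W : Type*) [AddCommGroup W] [Module ℂ W]

/-- The contraction with `ξ_b`, given by `ι_b w = 0` and
`ι_b (Y ∧ f) = (Y, ξ_b) f - (-1)^{|ξ_b||Y|} Y ∧ ι_b f`. -/
def contractData (hB : IsKillingForm B) (h : IsDualBasis P B par ξ ξd) (b : ι) :
    RecData P.nbar W where
  s := -twistN P (par b)
  P := LinearMap.toSpanSingleton ℂ _ LinearMap.id ∘ₗ B.flip (ξ b : g) ∘ₗ P.nbar.subtype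
  D₀ := 0
  s_mem i Y hY := Submodule.neg_mem _ (twistN_mem P _ i Y hY)
  rel i j X Y hX hY f := by
    -- X pairs with ξ_b only if their parities agree, so the signs depending on |X| and on |ξ_b| may
    -- be exchanged in front of (X, ξ_b).
    have hX0 : B (X : g) (ξ b : g) = koszul i j * koszul j (par b) * B (X : g) (ξ b : g) := by
      by_cases hi : i = par b
      · rw [hi, koszul_comm, koszul_sq, one_mul]
      · rw [hB.eq_zero hi hX (h.homogeneous b), mul_zero]
    have hY0 : B (Y : g) (ξ b : g) = koszul i j * koszul i (par b) * B (Y : g) (ξ b : g) := by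
      by_cases hj : j = par b
      · rw [hj, koszul_sq, one_mul]
      · rw [hB.eq_zero hj hY (h.homogeneous b), mul_zero]
    simp only [LinearMap.comp_apply, LinearMap.toSpanSingleton_apply, LinearMap.smul_apply,
      LinearMap.id_apply, LinearMap.flip_apply, Submodule.subtype_apply, LinearMap.neg_apply,
      twistN_of_mem P _ hX, twistN_of_mem P _ hY, map_neg, map_smul, wedge_neg, wedge_smul]
    match_scalars
    · rw [koszul_comm (par b) j]; linear_combination hX0
    · rw [koszul_comm (par b) i]
      have e' := koszul_sq i (par b)
      linear_combination (-koszul i (par b)) * hY0 - koszul i j * B (Y : g) (ξ b : g) * e'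

/-- The contraction with `ξ_b`. -/
def contract (hB : IsKillingForm B) (h : IsDualBasis P B par ξ ξd) (b : ι) :
    Module.End ℂ (Chains P.nbar W) := (contractData W hB h b).op

variable {W} (hB : IsKillingForm B) (h : IsDualBasis P B par ξ ξd)

omit [Fintype ι] in
theorem contract_one (b : ι) (w : W) : contract W hB h b (tmul _ W 1 w) = 0 :=
  RecData.op_one _ w

omit [Fintype ι] in
theorem contract_wedge (b : ι) {i : ZMod 2} {Y : P.nbar} (hY : (Y : g) ∈ gr (V := g) i)
    (f : Chains P.nbar W) :
    contract W hB h b (wedge (ext _ Y) f) =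
      B (Y : g) (ξ b : g) • f - koszul (par b) i • wedge (ext _ Y) (contract W hB h b f) := by
  refine (RecData.op_wedge _ Y f).trans ?_
  change B (Y : g) (ξ b : g) • f + wedge (ext _ (-twistN P (par b) Y)) (contract W hB h b f) = _
  rw [twistN_of_mem P _ hY, map_neg, wedge_neg, map_smul, wedge_smul, sub_eq_add_neg]

theorem contract_wedge_dual (a b : ι) (f : Chains P.nbar W) :
    contract W hB h b (wedge (ext _ (ξd a)) f) = (if a = b then f else 0) -
      koszul (par b) (par a) • wedge (ext _ (ξd a)) (contract W hB h b f) := by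
  rw [contract_wedge hB h b (h.homogeneous_dual hB a), h.dual, ite_smul, one_smul, zero_smul]

/-- Contractions obey the sign rule of the generators ξ_a^‡ of Λ n̄, as adjoints of left
multiplications should. This relation supplies the inductive step of `chainForm_succ_wedge`. -/
theorem contract_contract (a b : ι) (f : Chains P.nbar W) :
    contract W hB h a (contract W hB h b f) =
      -(koszul (par a) (par b) • contract W hB h b (contract W hB h a f)) := by
  suffices H : contract W hB h a * contract W hB h b =
      -(koszul (par a) (par b) • (contract W hB h b * contract W hB h a)) from
    LinearMap.congr_fun H f
  refine linearMap_ext_of_basis ξd (fun w => ?_) fun c f hf => ?_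
  · simp [contract_one]
  · simp only [Module.End.mul_apply, LinearMap.neg_apply, LinearMap.smul_apply] at hf ⊢
    rw [contract_wedge_dual, contract_wedge_dual]
    simp only [map_sub, map_smul]
    rw [contract_wedge_dual, contract_wedge_dual, hf]
    have e := koszul_sq (par a) (par b)
    have e1 := koszul_comm (par b) (par a)
    by_cases hcb : c = b <;> by_cases hca : c = a
    · subst hcb; subst hca
      simp only [if_true, map_neg, map_smul]
      match_scalars <;> first | ring1 | linear_combination -e
    · subst hcb
      simp only [if_true, if_neg hca, map_zero, map_neg, map_smul]
      match_scalars
      · linear_combination -e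
      · ring
    · subst hca
      simp only [if_true, if_neg hcb, map_zero, map_neg, map_smul]
      match_scalars
      · rw [e1]
      · ring
    · simp only [if_neg hca, if_neg hcb, map_zero, map_neg, map_smul]
      match_scalars
      ring

omit [Fintype ι] in
theorem contract_chains_zero (b : ι) {f : Chains P.nbar W} (hf : f ∈ chains P.nbar W 0) :
    contract W hB h b f = 0 :=
  (chains_zero_le (fun w => contract_one hB h b w) :
    chains P.nbar W 0 ≤ LinearMap.ker (contract W hB h b)) hf

theorem contract_chains_succ (b : ι) (k : ℕ) :
    chains P.nbar W (k + 1) ≤ (chains P.nbar W k).comap (contract W hB h b) := by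
  induction k with
  | zero =>
    refine chains_succ_le_of_basis ξd fun a f hf => ?_
    rw [Submodule.mem_comap, contract_wedge_dual, contract_chains_zero hB h b hf, map_zero,
      smul_zero, sub_zero]
    split_ifs
    exacts [hf, Submodule.zero_mem _]
  | succ k ih =>
    refine chains_succ_le_of_basis ξd fun a f hf => ?_
    rw [Submodule.mem_comap, contract_wedge_dual]
    refine Submodule.sub_mem _ ?_ (Submodule.smul_mem _ _ (wedge_mem_chains _ (ih hf)))
    split_ifs
    exacts [hf, Submodule.zero_mem _]

/-- Euler's identity `∑_a ξ_a^‡ ∧ ι_a f = k f` for `k`-chains. -/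
theorem sum_wedge_contract {k : ℕ} {f : Chains P.nbar W}
    (hf : f ∈ chains P.nbar W k) :
    ∑ a, wedge (ext _ (ξd a)) (contract W hB h a f) = (k : ℂ) • f := by
  suffices H : chains P.nbar W k ≤ LinearMap.eqLocus
      (∑ a, wedge (ext _ (ξd a)) ∘ₗ contract W hB h a) ((k : ℂ) • LinearMap.id) by
    simpa using H hf
  clear hf f
  induction k with
  | zero => exact chains_zero_le fun w => by simp [contract_one]
  | succ k ih =>
    refine chains_succ_le_of_basis ξd fun c f hf => ?_
    have hf' := ih hf
    simp only [LinearMap.mem_eqLocus, LinearMap.sum_apply, LinearMap.comp_apply,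
      LinearMap.smul_apply, LinearMap.id_apply] at hf' ⊢
    have key : ∀ a, wedge (ext _ (ξd a)) (contract W hB h a (wedge (ext _ (ξd c)) f)) =
        (if c = a then wedge (ext _ (ξd a)) f else 0) +
          wedge (ext _ (ξd c)) (wedge (ext _ (ξd a)) (contract W hB h a f)) := by
      intro a
      rw [contract_wedge_dual, map_sub, map_smul,
        wedge_wedge (h.homogeneous_dual hB a) (h.homogeneous_dual hB c), smul_neg, smul_smul,
        koszul_sq, one_smul, sub_neg_eq_add]
      split_ifs <;> simp
    simp only [key, Finset.sum_add_distrib, Finset.sum_ite_eq, Finset.mem_univ, if_true]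
    rw [← map_sum, hf', map_smul]
    push_cast
    rw [add_smul, one_smul, add_comm]

end Contraction

/-! ### The hermitian forms on `Λ n̄ ⊗ W` -/

section Form

variable {g : Type*} [AddCommGroup g] [Module ℂ g] [LieSuperalgebra g]
  {P : Parabolic g} {B : g →ₗ[ℂ] g →ₗ[ℂ] ℂ} {ι : Type*} [Fintype ι] [DecidableEq ι]
  {par : ι → ZMod 2} {ξ : Module.Basis ι ℂ P.n} {ξd : Module.Basis ι ℂ P.nbar}
  {W : Type*} [AddCommGroup W] [Module ℂ W]
  (hB : IsKillingForm B) (h : IsDualBasis P B par ξ ξd) (H : W →ₛₗ[starRingEnd ℂ] W →ₗ[ℂ] ℂ)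

/-- The hermitian form on `Λ^k n̄ ⊗ W` induced by a hermitian form on `W`, for which the `ξ_a^‡` are
orthonormal. It vanishes on the chains of other degrees. -/
def chainForm : ℕ → (Chains P.nbar W →ₛₗ[starRingEnd ℂ] Chains P.nbar W →ₗ[ℂ] ℂ)
  | 0 => (H.comp (degZero P.nbar W)).compl₂ (degZero P.nbar W)
  -- If ι_a is adjoint to multiplication by ξ_a^‡, the sum over a equals ⟨∑ ξ_a^‡ ∧ ι_a f, e⟩, which
  -- is k + 1 times ⟨f, e⟩ by Euler's identity; hence the normalisation.
  | k + 1 => ((k : ℂ) + 1)⁻¹ •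
      ∑ a, ((chainForm k).comp (contract W hB h a)).compl₂ (contract W hB h a)

theorem chainForm_zero (f e : Chains P.nbar W) :
    chainForm hB h H 0 f e = H (degZero _ W f) (degZero _ W e) := rfl

theorem chainForm_succ (k : ℕ) (f e : Chains P.nbar W) :
    chainForm hB h H (k + 1) f e = ((k : ℂ) + 1)⁻¹ *
      ∑ a, chainForm hB h H k (contract W hB h a f) (contract W hB h a e) := by
  simp [chainForm]

theorem chainForm_zero_wedge (Y : P.nbar) (f e : Chains P.nbar W) :
    chainForm hB h H 0 (wedge (ext _ Y) f) e = 0 := by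
  rw [chainForm_zero, degZero_wedge, map_zero, LinearMap.zero_apply]

theorem chainForm_succ_one (k : ℕ) (w : W) (e : Chains P.nbar W) :
    chainForm hB h H (k + 1) (tmul _ W 1 w) e = 0 := by
  rw [chainForm_succ]
  simp [contract_one]

/-- Contraction is adjoint to left multiplication. -/
theorem chainForm_succ_wedge (k : ℕ) (b : ι) (f e : Chains P.nbar W) :
    chainForm hB h H (k + 1) (wedge (ext _ (ξd b)) f) e =
      chainForm hB h H k f (contract W hB h b e) := by
  induction k generalizing f e with
  | zero =>
    rw [chainForm_succ]
    simp only [contract_wedge_dual, map_sub, LinearMap.sub_apply, LinearMap.map_smulₛₗ,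
      LinearMap.smul_apply, chainForm_zero_wedge, smul_zero, sub_zero]
    rw [Finset.sum_eq_single b (fun a _ hab => by rw [if_neg hab.symm]; simp) (by simp)]
    simp
  | succ k ih =>
    rw [chainForm_succ]
    simp only [contract_wedge_dual, map_sub, LinearMap.sub_apply, LinearMap.map_smulₛₗ,
      LinearMap.smul_apply, ih, Finset.sum_sub_distrib, conj_koszul]
    rw [Finset.sum_eq_single b (fun a _ hab => by rw [if_neg hab.symm]; simp) (by simp), if_pos rfl]
    -- Here the induction hypothesis has already moved ξ_b^‡ across. Commuting ι_b with ι_a rebuilds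
    -- k + 1 copies of the degree k + 1 form, which together with the diagonal term a = b make k + 2
    -- and cancel the normalising factor.
    have key : ∑ a, koszul (par a) (par b) • chainForm hB h H k (contract W hB h a f)
        (contract W hB h b (contract W hB h a e)) =
        -(((k : ℂ) + 1) * chainForm hB h H (k + 1) f (contract W hB h b e)) := by
      rw [chainForm_succ, ← mul_assoc, mul_inv_cancel₀ (by exact_mod_cast k.succ_ne_zero), one_mul,
        ← Finset.sum_neg_distrib]
      refine Finset.sum_congr rfl fun a _ => ?_
      rw [contract_contract hB h b a, map_neg, map_smul, smul_neg, smul_smul,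
        koszul_comm (par b), koszul_sq, one_smul]
    rw [key, sub_neg_eq_add]
    have : ((k : ℂ) + 1 + 1) ≠ 0 := by exact_mod_cast (k + 1).succ_ne_zero
    push_cast
    field_simp
    ring

section Hermitian

variable {H} (hsymm : ∀ v w, H w v = conj (H v w)) (hpos : ∀ v, v ≠ 0 → 0 < (H v v).re)

include hsymm in
theorem chainForm_symm (k : ℕ) (f e : Chains P.nbar W) :
    chainForm hB h H k e f = conj (chainForm hB h H k f e) := by
  induction k generalizing f e with
  | zero => exact hsymm _ _
  | succ k ih =>
    rw [chainForm_succ, chainForm_succ, map_mul, map_sum]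
    congr 1
    · simp
    · exact Finset.sum_congr rfl fun a _ => ih _ _

theorem chainForm_succ_self_re (k : ℕ) (f : Chains P.nbar W) :
    (chainForm hB h H (k + 1) f f).re = ((k : ℝ) + 1)⁻¹ *
      ∑ a, (chainForm hB h H k (contract W hB h a f) (contract W hB h a f)).re := by
  rw [chainForm_succ, show ((k : ℂ) + 1)⁻¹ = (((k : ℝ) + 1)⁻¹ : ℝ) by push_cast; rfl,
    Complex.re_ofReal_mul, Complex.re_sum]

include hpos

theorem chainForm_self_nonneg (k : ℕ) (f : Chains P.nbar W) :
    0 ≤ (chainForm hB h H k f f).re := by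
  induction k generalizing f with
  | zero =>
    rw [chainForm_zero]
    by_cases h0 : degZero _ W f = 0
    · simp [h0]
    · exact (hpos _ h0).le
  | succ k ih =>
    rw [chainForm_succ_self_re]
    exact mul_nonneg (by positivity) (Finset.sum_nonneg fun a _ => ih _)

/-- The form is definite on `k`-chains. -/
theorem eq_zero_of_chainForm_self {k : ℕ} {f : Chains P.nbar W} (hf : f ∈ chains P.nbar W k)
    (h0 : (chainForm hB h H k f f).re = 0) : f = 0 := by
  induction k generalizing f with
  | zero =>
    have hle : chains P.nbar W 0 ≤ LinearMap.eqLocus (tmul P.nbar W 1 ∘ₗ degZero P.nbar W)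
        LinearMap.id := chains_zero_le fun w => by simp [degZero_one]
    have hf' : tmul P.nbar W 1 (degZero P.nbar W f) = f := hle hf
    rw [chainForm_zero] at h0
    by_cases hd : degZero _ W f = 0
    · rw [← hf', hd, map_zero]
    · exact absurd h0 (hpos _ hd).ne'
  | succ k ih =>
    rw [chainForm_succ_self_re] at h0
    have hsum := (mul_eq_zero.1 h0).resolve_left (by positivity)
    rw [Finset.sum_eq_zero_iff_of_nonneg fun a _ => chainForm_self_nonneg hB h hpos k _] at hsum
    -- All ι_a f vanish by induction, so Euler's identity gives (k + 1) f = 0.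
    have hN := sum_wedge_contract hB h hf
    rw [Finset.sum_eq_zero fun a ha => by
      rw [ih (contract_chains_succ hB h a k hf) (hsum a ha), map_zero]] at hN
    exact (smul_eq_zero.1 hN.symm).resolve_left (by exact_mod_cast k.succ_ne_zero)

end Hermitian

theorem chainForm_eq_zero_of_ne {j k : ℕ} (hjk : j ≠ k) {f : Chains P.nbar W}
    (hf : f ∈ chains P.nbar W j) (e : Chains P.nbar W) : chainForm hB h H k f e = 0 := by
  induction k generalizing j f e with
  | zero =>
    obtain ⟨j, rfl⟩ := Nat.exists_eq_succ_of_ne_zero hjk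
    have hle : chains P.nbar W (j + 1) ≤ LinearMap.ker (degZero P.nbar W) :=
      chains_succ_le fun Y f _ => degZero_wedge Y f
    rw [chainForm_zero, LinearMap.mem_ker.1 (hle hf), map_zero, LinearMap.zero_apply]
  | succ k ih =>
    rw [chainForm_succ, Finset.sum_eq_zero, mul_zero]
    intro a _
    rcases j with _ | j
    · rw [contract_chains_zero hB h a hf, map_zero, LinearMap.zero_apply]
    · exact ih (by omega) (contract_chains_succ hB h a j hf) _

include h in
-- The form of degree k sees only the k-th term of a decomposition of f into homogeneous chains, and
-- it is definite on that term. This extends definiteness from single degrees to all of Λ n̄ ⊗ W.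
theorem eq_zero_of_forall_chainForm_self (hsymm : ∀ v w, H w v = conj (H v w))
    (hpos : ∀ v, v ≠ 0 → 0 < (H v v).re) {f : Chains P.nbar W}
    (h0 : ∀ k, chainForm hB h H k f f = 0) : f = 0 := by
  obtain ⟨F, hF, rfl⟩ := (Submodule.mem_iSup_iff_exists_finsupp _ _).1
    (iSup_chains (N := P.nbar) (W := W) ▸ Submodule.mem_top : f ∈ ⨆ k, chains P.nbar W k)
  refine Finset.sum_eq_zero fun k hk => ?_
  have hleft : ∀ e, chainForm hB h H k (F.sum fun _ x => x) e = chainForm hB h H k (F k) e := by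
    intro e
    rw [Finsupp.sum, map_sum, LinearMap.sum_apply]
    exact Finset.sum_eq_single k
      (fun j _ hj => chainForm_eq_zero_of_ne hB h H hj (hF j) e) fun hk' => absurd hk hk'
  refine eq_zero_of_chainForm_self hB h hpos (hF k) ?_
  have := h0 k
  rw [hleft, chainForm_symm hB h hsymm, hleft, map_eq_zero] at this
  rw [this, Complex.zero_re]

end Form

/-! ### Commutators with contractions, Cartan's formula and the adjoint pairs -/

section Adjoints

variable {g : Type*} [AddCommGroup g] [Module ℂ g] [LieSuperalgebra g] [FiniteDimensional ℂ g]
  {P : Parabolic g} {B : g →ₗ[ℂ] g →ₗ[ℂ] ℂ} {ι : Type*} [Fintype ι] [DecidableEq ι]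
  {par : ι → ZMod 2} {ξ : Module.Basis ι ℂ P.n} {ξd : Module.Basis ι ℂ P.nbar}
  {W : Type*} [AddCommGroup W] [Module ℂ W] [SuperSpace W] [LieSupermodule g W]
  (hg : IsSimple g) (hB : IsKillingForm B) (h : IsDualBasis P B par ξ ξd)

include hg hB h in
theorem IsDualBasis.adN_eq_sum (A : g) (Y : P.nbar) :
    adN P A Y = ∑ c, B (br A (Y : g)) (ξ c : g) • ξd c := by
  conv_lhs => rw [← ξd.sum_repr (adN P A Y)]
  exact Finset.sum_congr rfl fun c _ => by
    rw [← h.repr_toNbar hg hB]; rfl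

include hg in
/-- The commutator of a contraction with the action of `A`. -/
theorem contract_act {a : ZMod 2} {A : g} (hA : A ∈ gr (V := g) a) (b : ι)
    (f : Chains P.nbar W) :
    contract W hB h b (act P W A f) = koszul a (par b) • act P W A (contract W hB h b f) +
      ∑ c, B (br A (ξd c : g)) (ξ b : g) • contract W hB h c f := by
  suffices H : contract W hB h b * act P W A = koszul a (par b) • (act P W A * contract W hB h b) +
      ∑ c, B (br A (ξd c : g)) (ξ b : g) • contract W hB h c by
    simpa using LinearMap.congr_fun H f
  refine linearMap_ext_of_basis ξd (fun w => ?_) fun d f hf => ?_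
  · simp [contract_one, act_one]
  · simp only [Module.End.mul_apply, LinearMap.add_apply, LinearMap.smul_apply,
      LinearMap.sum_apply] at hf ⊢
    have hd := h.homogeneous_dual hB d
    -- The structure constant vanishes unless |A| + |ξ_c| = |ξ_b|, which lets a sign depending on c
    -- be pulled out of the sum.
    have hM : ∀ c, B (br A (ξd c : g)) (ξ b : g) * koszul (par c) (par d) =
        koszul a (par d) * koszul (par b) (par d) * B (br A (ξd c : g)) (ξ b : g) := by
      intro c
      by_cases hc : a + par c = par b
      · rw [← hc, koszul_add_left]
        linear_combination (-B (br A (ξd c : g)) (ξ b : g) * koszul (par c) (par d)) *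
          koszul_sq a (par d)
      · rw [hB.eq_zero hc (br_mem hA (h.homogeneous_dual hB c)) (h.homogeneous b), zero_mul,
          mul_zero]
    have hS : ∑ c, B (br A (ξd c : g)) (ξ b : g) •
        contract W hB h c (wedge (ext _ (ξd d)) f) = B (br A (ξd d : g)) (ξ b : g) • f -
        (koszul a (par d) * koszul (par b) (par d)) • wedge (ext _ (ξd d))
          (∑ c, B (br A (ξd c : g)) (ξ b : g) • contract W hB h c f) := by
      simp only [contract_wedge_dual, smul_sub, Finset.sum_sub_distrib, smul_ite, smul_zero,
        Finset.sum_ite_eq, Finset.mem_univ, if_true, map_sum, map_smul, Finset.smul_sum, smul_smul,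
        hM]
    have hadN : B (adN P A (ξd d) : g) (ξ b : g) = B (br A (ξd d : g)) (ξ b : g) := by
      rw [← h.repr_nbar, ← h.repr_toNbar hg hB]; rfl
    rw [hS, act_wedge P hA hd, map_add, map_smul, contract_wedge hB h b (adN_mem P hA hd), hadN,
      contract_wedge_dual, hf, contract_wedge_dual, map_sub, map_smul, act_wedge P hA hd]
    simp only [map_add, map_smul, koszul_add_right, koszul_comm (par b) a]
    by_cases hdb : d = b
    · subst hdb
      simp only [if_true]
      match_scalars <;> ring
    · simp only [if_neg hdb, map_zero]
      match_scalars <;> ring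

omit [FiniteDimensional ℂ g] in
theorem contract_parityOp (b : ι) (f : Chains P.nbar W) :
    contract W hB h b (parityOp P W f) =
      koszul 1 (par b) • parityOp P W (contract W hB h b f) := by
  suffices H : contract W hB h b * parityOp P W =
      koszul 1 (par b) • (parityOp P W * contract W hB h b) from LinearMap.congr_fun H f
  refine linearMap_ext_of_basis ξd (fun w => ?_) fun d f hf => ?_
  · simp [contract_one, parityOp_one]
  · simp only [Module.End.mul_apply, LinearMap.smul_apply] at hf ⊢
    have hd := h.homogeneous_dual hB d
    rw [parityOp_wedge P hd, map_smul, contract_wedge_dual, hf, contract_wedge_dual, map_sub,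
      map_smul, map_smul, parityOp_wedge P hd]
    by_cases hdb : d = b
    · subst hdb
      simp only [if_true]
    · simp only [if_neg hdb, map_zero]
      match_scalars
      ring

omit [SuperSpace W] [LieSupermodule g W] in
include hg in
-- Contracting the first or the second factor of ½ ∑ ± ξ_a^‡ ∧ [ξ_a, Y]_{n̄} gives the same result,
-- by invariance and supersymmetry of the form (`hswap`). The two halves add up to the first term on
-- the right. The second term arises from moving ι_b past an element of exterior degree 2 and parity
-- |Y|.
theorem contract_cobracket (b : ι) {i : ZMod 2} {Y : P.nbar} (hY : (Y : g) ∈ gr (V := g) i)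
    (f : Chains P.nbar W) :
    contract W hB h b (wedge (cobracket par ξ ξd Y) f) =
      koszul (par b) (par b) • wedge (ext _ (adN P (ξ b : g) Y)) f +
        koszul (par b) i • wedge (cobracket par ξ ξd Y) (contract W hB h b f) := by
  have hcob : ∀ e : Chains P.nbar W, wedge (cobracket par ξ ξd Y) e =
      (1 / 2 : ℂ) • ∑ a, koszul (par a) (par a) •
        wedge (ext _ (ξd a)) (wedge (ext _ (adN P (ξ a : g) Y)) e) := by
    intro e
    change wedgeL P.nbar W (cobracket par ξ ξd Y) e = _
    simp only [cobracket, LinearMap.smul_apply, LinearMap.sum_apply, map_smul, map_sum,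
      LinearMap.comp_apply, LinearMap.mulLeft_apply, ← wedge_mul]
    rfl
  have hadN : ∀ a, B (adN P (ξ a : g) Y : g) (ξ b : g) = B (br (ξ a : g) (Y : g)) (ξ b : g) := by
    intro a
    rw [← h.repr_nbar, ← h.repr_toNbar hg hB]; rfl
  have hswap : ∀ a, koszul (par a) (par a) * koszul (par b) (par a) *
      B (br (ξ a : g) (Y : g)) (ξ b : g) =
        -(koszul (par b) (par b) * B (br (ξ b : g) (Y : g)) (ξ a : g)) := by
    intro a
    rw [hB.invariant, br_skew hY (h.homogeneous b), map_neg, map_smul, smul_eq_mul]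
    by_cases hc : par a = par b + i
    · rw [hB.supersymmetric (h.homogeneous a) (br_mem (h.homogeneous b) hY), ← hc]
      have e1 : koszul (par b) (par a) * koszul i (par b) = koszul (par b) (par b) := by
        rw [hc, koszul_add_right, mul_assoc, koszul_comm i, koszul_sq, mul_one]
      have e2 := koszul_sq (par a) (par a)
      linear_combination (-(koszul (par a) (par a) * koszul (par a) (par a)) *
        B (br (ξ b : g) (Y : g)) (ξ a : g)) * e1 - koszul (par b) (par b) *
        B (br (ξ b : g) (Y : g)) (ξ a : g) * e2
    · rw [hB.eq_zero hc (h.homogeneous a) (br_mem (h.homogeneous b) hY),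
        hB.eq_zero (Ne.symm hc) (br_mem (h.homogeneous b) hY) (h.homogeneous a)]
      ring
  have hterm : ∀ a, koszul (par a) (par a) • contract W hB h b
      (wedge (ext _ (ξd a)) (wedge (ext _ (adN P (ξ a : g) Y)) f)) =
      (if a = b then koszul (par b) (par b) • wedge (ext _ (adN P (ξ b : g) Y)) f else 0) +
      koszul (par b) (par b) • B (br (ξ b : g) (Y : g)) (ξ a : g) • wedge (ext _ (ξd a)) f +
      koszul (par b) i • koszul (par a) (par a) • wedge (ext _ (ξd a))
        (wedge (ext _ (adN P (ξ a : g) Y)) (contract W hB h b f)) := by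
    intro a
    rw [contract_wedge_dual, contract_wedge hB h b (adN_mem P (h.homogeneous a) hY), hadN]
    have e1 := hswap a
    have e2 := koszul_sq (par b) (par a)
    simp only [map_sub, map_smul, koszul_add_right]
    by_cases hab : a = b
    · subst hab
      simp only [if_true]
      match_scalars
      · ring
      · linear_combination -e1
      · linear_combination koszul (par a) i * koszul (par a) (par a) * e2
    · simp only [if_neg hab]
      match_scalars
      · linear_combination -e1
      · linear_combination koszul (par b) i * koszul (par a) (par a) * e2
  have hsum : ∑ a, B (br (ξ b : g) (Y : g)) (ξ a : g) • wedge (ext P.nbar (ξd a)) f =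
      wedge (ext _ (adN P (ξ b : g) Y)) f := by
    rw [h.adN_eq_sum hg hB]
    change _ = wedgeL P.nbar W (ext P.nbar _) f
    simp only [map_sum, map_smul, LinearMap.sum_apply, LinearMap.smul_apply]
    rfl
  rw [hcob, hcob]
  simp only [map_smul, map_sum, hterm, Finset.sum_add_distrib, Finset.sum_ite_eq', Finset.mem_univ,
    if_true, ← Finset.smul_sum, hsum]
  match_scalars <;> ring

include hg in
/-- Cartan's formula. -/
theorem contract_coboundary (b : ι) (f : Chains P.nbar W) :
    contract W hB h b (coboundary W hB h f) + coboundary W hB h (contract W hB h b f) =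
      koszul (par b) (par b) • act P W (ξ b : g) f := by
  suffices H : contract W hB h b * coboundary W hB h + coboundary W hB h * contract W hB h b =
      koszul (par b) (par b) • act P W (ξ b : g) from LinearMap.congr_fun H f
  have hcw : ∀ (Y : P.nbar) (f : Chains P.nbar W), coboundary W hB h (wedge (ext _ Y) f) =
      wedge (cobracket par ξ ξd Y) f - wedge (ext _ Y) (coboundary W hB h f) := by
    intro Y f
    refine (RecData.op_wedge _ Y f).trans ?_
    change wedge (cobracket par ξ ξd Y) f + wedge (ext _ (-Y)) (coboundary W hB h f) = _
    rw [map_neg, wedge_neg, ← sub_eq_add_neg]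
  refine linearMap_ext_of_basis ξd (fun w => ?_) fun d f hf => ?_
  · simp only [Module.End.mul_apply, LinearMap.add_apply, LinearMap.smul_apply, contract_one,
      map_zero, add_zero, coboundary_one, map_sum, map_smul, act_one]
    rw [Finset.sum_eq_single b]
    · have := contract_wedge_dual (W := W) hB h b b (tmul P.nbar W 1 (LieSupermodule.smul (ξ b : g) w))
      rw [wedge_tmul, mul_one, contract_one, if_pos rfl, map_zero, smul_zero, sub_zero] at this
      rw [this]
    · intro a _ hab
      have := contract_wedge_dual (W := W) hB h a b (tmul P.nbar W 1 (LieSupermodule.smul (ξ a : g) w))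
      rw [wedge_tmul, mul_one, contract_one, if_neg hab, map_zero, smul_zero, sub_zero] at this
      rw [this, smul_zero]
    · simp
  · simp only [Module.End.mul_apply, LinearMap.add_apply, LinearMap.smul_apply] at hf ⊢
    have hd := h.homogeneous_dual hB d
    -- Between the two summands the terms in δf and in `cobracket` applied to ι_b f cancel. What
    -- remains is the recursion defining ξ_b[·], up to the sign (-1)^{|ξ_b|}.
    have hf' := eq_sub_of_add_eq hf
    rw [hcw, map_sub, contract_cobracket hg hB h b hd, contract_wedge_dual, contract_wedge_dual,
      map_sub, map_smul, hcw, act_wedge P (h.homogeneous b) hd, hf']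
    simp only [map_sub, map_smul]
    by_cases hdb : d = b
    · subst hdb
      simp only [if_true]
      match_scalars <;> ring
    · simp only [if_neg hdb, map_zero]
      match_scalars <;> ring

variable {dag : g →ₛₗ[starRingEnd ℂ] g} (hdag : IsAdjointOperation dag)
  (hdual : ∀ a, dag (ξ a : g) = koszul (par a) (par a) • (ξd a : g))
  {H : W →ₛₗ[starRingEnd ℂ] W →ₗ[ℂ] ℂ}
  (hH : ∀ (A : g) (v w : W), H (LieSupermodule.smul A v) w = H v (LieSupermodule.smul (dag A) w))

omit [FiniteDimensional ℂ g] in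
theorem degZero_act (A : g) (f : Chains P.nbar W) :
    degZero _ W (act P W A f) = LieSupermodule.smul A (degZero _ W f) := by
  have key : ∀ a, ∀ A ∈ gr (V := g) a, degZero _ W (act P W A f) =
      LieSupermodule.smul A (degZero _ W f) := by
    intro a A hA
    have : f ∈ LinearMap.eqLocus (degZero P.nbar W ∘ₗ act P W A)
        (LieSupermodule.smul A ∘ₗ degZero P.nbar W) := by
      rw [eq_top_of_wedge (S := LinearMap.eqLocus _ _)]
      · exact Submodule.mem_top
      · intro w
        simp [act_one, degZero_one]
      · intro Y f _
        simp [act_eq P W hA, actHom_wedge, degZero_wedge]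
    exact this
  rw [← proj_add A]
  simp only [map_add, LinearMap.add_apply, key 0 _ (proj_mem 0 A), key 1 _ (proj_mem 1 A)]

omit [FiniteDimensional ℂ g] in
theorem degZero_coboundary (f : Chains P.nbar W) : degZero _ W (coboundary W hB h f) = 0 := by
  suffices H : degZero P.nbar W ∘ₗ coboundary W hB h = 0 from LinearMap.congr_fun H f
  refine linearMap_ext_of_basis ξd (fun w => ?_) fun b f hf => ?_
  · have key : ∀ (Y : P.nbar) (w : W), degZero _ W (tmul _ W (ext _ Y) w) = 0 := by
      intro Y w
      have := degZero_wedge Y (tmul P.nbar W 1 w)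
      rwa [wedge_tmul, mul_one] at this
    simp [coboundary_one, key]
  · simp [coboundary_wedge, degZero_wedge]

include hg hB h hdag hdual in
-- Conjugation replaces all entries by their images under †, and invariance moves the bracket back
-- to ξ_c^‡. The two uses of skew-symmetry leave a sign (-1)^{|A|} when |A| + |ξ_c| = |ξ_b|; the
-- signs in ξ_b^† and ξ_c^† contribute the same factor, so everything cancels. In all other parities
-- both sides are 0.
theorem IsDualBasis.conj_structure {a : ZMod 2} {A : g} (hA : A ∈ gr (V := g) a) (b c : ι) :
    conj (B (br A (ξd b : g)) (ξ c : g)) = B (br (dag A) (ξd c : g)) (ξ b : g) := by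
  have hA' := hdag.even a A hA
  rw [h.conj_form hg hB hdag hdual b, hdag.br, hdual, hdag.dag_dual hdual]
  simp only [map_smul, LinearMap.smul_apply, smul_eq_mul]
  rw [br_skew (h.homogeneous b) hA', map_neg, map_smul, ← hB.invariant,
    br_skew (h.homogeneous_dual hB c) hA', map_neg, map_smul, LinearMap.neg_apply,
    LinearMap.smul_apply]
  simp only [smul_eq_mul]
  by_cases hc : a + par c = par b
  · rw [← hc]
    have h1 := koszul_sq a a
    have h2 := koszul_sq (par c) (par c)
    have h3 := koszul_sq (par c) a
    have h4 := koszul_comm (par c) a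
    simp only [koszul_add_left, koszul_add_right, ← h4]
    generalize B (br (dag A) (ξd c : g)) (ξ b : g) = x
    generalize koszul a a = p at *
    generalize koszul (par c) (par c) = q at *
    generalize koszul (par c) a = r at *
    have hp : p * p * (q * q) * (r * r) * (r * r) = 1 := by rw [h1, h2, h3]; ring
    linear_combination x * hp
  · rw [hB.eq_zero hc (br_mem hA' (h.homogeneous_dual hB c)) (h.homogeneous b)]
    ring

include hg hdag hdual hH

/-- The operators of `A` and `A^†` are adjoint to each other. -/
theorem chainForm_act_of_mem {a : ZMod 2} {A : g} (hA : A ∈ gr (V := g) a) (k : ℕ)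
    (f e : Chains P.nbar W) :
    chainForm hB h H k (act P W A f) e = chainForm hB h H k f (act P W (dag A) e) := by
  have hA' := hdag.even a A hA
  let S : Submodule ℂ (Chains P.nbar W) :=
    { carrier := {f | ∀ k e, chainForm hB h H k (act P W A f) e =
        chainForm hB h H k f (act P W (dag A) e)}
      zero_mem' := fun k e => by simp
      add_mem' := fun {x y} hx hy k e => by
        simp only [map_add, LinearMap.add_apply, hx k e, hy k e]
      smul_mem' := fun c x hx k e => by
        simp only [map_smul, LinearMap.map_smulₛₗ, LinearMap.smul_apply, hx k e] }
  suffices hS : S = ⊤ from (hS ▸ Submodule.mem_top : f ∈ S) k e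
  refine eq_top_of_basis ξd (fun w k e => ?_) fun b f hf k e => ?_
  · rw [act_one]
    cases k with
    | zero => rw [chainForm_zero, chainForm_zero, degZero_one, degZero_one, degZero_act, hH]
    | succ k => rw [chainForm_succ_one, chainForm_succ_one]
  · have hb := h.homogeneous_dual hB b
    cases k with
    | zero =>
      rw [act_eq P W hA, actHom_wedge, map_add, LinearMap.add_apply, chainForm_zero_wedge,
        chainForm_zero_wedge, chainForm_zero_wedge, add_zero]
    | succ k =>
      have hsum : wedge (ext P.nbar (adN P A (ξd b))) f =
          ∑ c, B (br A (ξd b : g)) (ξ c : g) • wedge (ext P.nbar (ξd c)) f := by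
        rw [h.adN_eq_sum hg hB]
        change wedgeL P.nbar W (ext P.nbar _) f = _
        simp only [map_sum, map_smul, LinearMap.sum_apply, LinearMap.smul_apply]
        rfl
      -- Moving ξ_b^‡ across turns the right side into ι_b A^†[e]. Commuting ι_b with A^† gives one
      -- term covered by the induction hypothesis and a sum of contractions, which matches [A,
      -- ξ_b^‡]_{n̄} ∧ f by `conj_structure`.
      rw [act_wedge P hA hb, map_add, LinearMap.add_apply, chainForm_succ_wedge,
        contract_act hg hB h hA', hsum, map_sum, LinearMap.sum_apply, map_add, map_sum, add_comm]
      simp only [LinearMap.map_smulₛₗ, LinearMap.smul_apply, chainForm_succ_wedge, conj_koszul,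
        h.conj_structure hg hB hdag hdual hA, map_smul]
      rw [hf k]

theorem chainForm_act (A : g) (k : ℕ) (f e : Chains P.nbar W) :
    chainForm hB h H k (act P W A f) e = chainForm hB h H k f (act P W (dag A) e) := by
  rw [← proj_add A]
  simp only [map_add, LinearMap.add_apply,
    chainForm_act_of_mem hg hB h hdag hdual hH (proj_mem 0 A),
    chainForm_act_of_mem hg hB h hdag hdual hH (proj_mem 1 A)]

/-- The operators `δ^*` and `-δ` are adjoint to each other. -/
theorem chainForm_boundary (k : ℕ) (f e : Chains P.nbar W) :
    chainForm hB h H k (boundary P W f) e = -chainForm hB h H (k + 1) f (coboundary W hB h e) := by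
  let S : Submodule ℂ (Chains P.nbar W) :=
    { carrier := {f | ∀ k e, chainForm hB h H k (boundary P W f) e =
        -chainForm hB h H (k + 1) f (coboundary W hB h e)}
      zero_mem' := fun k e => by simp
      add_mem' := fun {x y} hx hy k e => by
        simp only [map_add, LinearMap.add_apply, hx k e, hy k e, neg_add]
      smul_mem' := fun c x hx k e => by
        simp only [map_smul, LinearMap.map_smulₛₗ, LinearMap.smul_apply, hx k e, smul_neg] }
  suffices hS : S = ⊤ from (hS ▸ Submodule.mem_top : f ∈ S) k e
  refine eq_top_of_basis ξd (fun w k e => ?_) fun b f hf k e => ?_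
  · rw [boundary_one, map_zero, LinearMap.zero_apply, chainForm_succ_one, neg_zero]
  -- The adjoint of ξ_b^‡[·] is (-1)^{|ξ_b|} ξ_b[·] = ι_b δ + δ ι_b. The first summand is the wanted
  -- term; the second cancels against ξ_b^‡ ∧ δ^*f, by the induction hypothesis if k > 0 and because
  -- δ has no component in degree 0 if k = 0.
  · rw [boundary_wedge, map_sub, map_neg, LinearMap.sub_apply, LinearMap.neg_apply,
      chainForm_act hg hB h hdag hdual hH, hdag.dag_dual hdual, map_smul, LinearMap.smul_apply,
      ← contract_coboundary hg hB h, map_add, chainForm_succ_wedge]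
    cases k with
    | zero =>
      rw [chainForm_zero_wedge, chainForm_zero hB h H f (coboundary W hB h _), degZero_coboundary,
        map_zero]
      ring
    | succ k =>
      rw [chainForm_succ_wedge, hf]
      ring

end Adjoints

/-! ### Compatibility of the forms with the parity involution -/

section Parity

variable {V : Type*} [AddCommGroup V] [Module ℂ V] [SuperSpace V]

theorem twist_one_twist_one (x : V) : twist 1 (twist 1 x) = x := by
  have key : ∀ i, twist 1 (twist 1 (proj i x)) = proj i x := fun i => by
    rw [twist_of_mem 1 (proj_mem i x), map_smul, twist_of_mem 1 (proj_mem i x), smul_smul,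
      koszul_sq, one_smul]
  rw [← proj_add x, map_add, map_add, key, key]

variable {g : Type*} [AddCommGroup g] [Module ℂ g] [LieSuperalgebra g]
  {W : Type*} [AddCommGroup W] [Module ℂ W] [SuperSpace W] [LieSupermodule g W]

theorem twist_one_smul {a : ZMod 2} {A : g} (hA : A ∈ gr (V := g) a) (w : W) :
    twist 1 (LieSupermodule.smul A w) = koszul 1 a • LieSupermodule.smul A (twist 1 w) := by
  have key : ∀ j, twist 1 (LieSupermodule.smul A (proj j w)) =
      koszul 1 a • LieSupermodule.smul A (twist 1 (proj j w)) := by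
    intro j
    rw [twist_of_mem 1 (LieSupermodule.smul_mem hA (proj_mem j w)), twist_of_mem 1 (proj_mem j w),
      koszul_add_right, map_smul, smul_smul]
  rw [← proj_add w]
  simp only [map_add, smul_add, key]

/-- The inner product of a star representation can be chosen such that the even and the odd part
are orthogonal. -/
theorem IsStarRepresentation.exists_form {dag : g →ₛₗ[starRingEnd ℂ] g}
    (hdag : IsAdjointOperation dag) (hstar : IsStarRepresentation W dag) :
    ∃ H : W →ₛₗ[starRingEnd ℂ] W →ₗ[ℂ] ℂ,
      (∀ v w, H w v = conj (H v w)) ∧ (∀ v, v ≠ 0 → 0 < (H v v).re) ∧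
      (∀ (A : g) (v w : W),
        H (LieSupermodule.smul A v) w = H v (LieSupermodule.smul (dag A) w)) ∧
      ∀ v w, H (twist 1 v) w = H v (twist 1 w) := by
  obtain ⟨H, hsymm, hpos, hadj⟩ := hstar
  have hH : ∀ v w, (H + (H.comp (twist 1)).compl₂ (twist 1)) v w =
      H v w + H (twist 1 v) (twist 1 w) := fun v w => rfl
  -- The inner product is averaged, up to the factor ½, over the group of order 2 generated by the
  -- parity involution.
  refine ⟨H + (H.comp (twist 1)).compl₂ (twist 1), fun v w => ?_, fun v hv => ?_,
    fun A v w => ?_, fun v w => ?_⟩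
  · rw [hH, hH, map_add, hsymm v w, hsymm (twist 1 v)]
  · rw [hH, Complex.add_re]
    refine add_pos (hpos v hv) (hpos _ fun h0 => hv ?_)
    rw [← twist_one_twist_one v, h0, map_zero]
  -- As † is even, A and A^† acquire the same sign when they pass the involution, so the twisted
  -- form has the same adjoints.
  · have key : ∀ a, ∀ A ∈ gr (V := g) a, H (twist 1 (LieSupermodule.smul A v)) (twist 1 w) =
        H (twist 1 v) (twist 1 (LieSupermodule.smul (dag A) w)) := by
      intro a A hA
      rw [twist_one_smul hA, twist_one_smul (hdag.even a A hA), LinearMap.map_smulₛₗ, conj_koszul,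
        LinearMap.smul_apply, hadj, map_smul]
    rw [hH, hH, hadj]
    congr 1
    rw [← proj_add A]
    simp only [map_add, LinearMap.add_apply, key 0 _ (proj_mem 0 A), key 1 _ (proj_mem 1 A)]
  · rw [hH, hH, twist_one_twist_one, twist_one_twist_one, add_comm]

variable {P : Parabolic g}

theorem degZero_parityOp (f : Chains P.nbar W) :
    degZero _ W (parityOp P W f) = twist 1 (degZero _ W f) := by
  have : f ∈ LinearMap.eqLocus (degZero P.nbar W ∘ₗ parityOp P W)
      (twist 1 ∘ₗ degZero P.nbar W) := by
    rw [eq_top_of_wedge (S := LinearMap.eqLocus _ _)]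
    · exact Submodule.mem_top
    · intro w
      simp [parityOp_one, degZero_one]
    · intro Y f _
      have hp : parityOp P W (wedge (ext _ Y) f) =
          0 + wedge (ext _ (twistN P 1 Y)) (parityOp P W f) := RecData.op_wedge _ Y f
      simp [hp, degZero_wedge]
  exact this

/-- Parity is self-adjoint, so orthogonal complements of graded subspaces of chains are graded. -/
theorem chainForm_parityOp {B : g →ₗ[ℂ] g →ₗ[ℂ] ℂ} {ι : Type*} [Fintype ι] [DecidableEq ι]
    {par : ι → ZMod 2} {ξ : Module.Basis ι ℂ P.n} {ξd : Module.Basis ι ℂ P.nbar}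
    (hB : IsKillingForm B) (h : IsDualBasis P B par ξ ξd)
    {H : W →ₛₗ[starRingEnd ℂ] W →ₗ[ℂ] ℂ} (hH : ∀ v w, H (twist 1 v) w = H v (twist 1 w))
    (k : ℕ) (f e : Chains P.nbar W) :
    chainForm hB h H k (parityOp P W f) e = chainForm hB h H k f (parityOp P W e) := by
  let S : Submodule ℂ (Chains P.nbar W) :=
    { carrier := {f | ∀ k e, chainForm hB h H k (parityOp P W f) e =
        chainForm hB h H k f (parityOp P W e)}
      zero_mem' := fun k e => by simp
      add_mem' := fun {x y} hx hy k e => by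
        simp only [map_add, LinearMap.add_apply, hx k e, hy k e]
      smul_mem' := fun c x hx k e => by
        simp only [map_smul, LinearMap.map_smulₛₗ, LinearMap.smul_apply, hx k e] }
  suffices hS : S = ⊤ from (hS ▸ Submodule.mem_top : f ∈ S) k e
  refine eq_top_of_basis ξd (fun w k e => ?_) fun b f hf k e => ?_
  · rw [parityOp_one]
    cases k with
    | zero => rw [chainForm_zero, chainForm_zero, degZero_one, degZero_one, degZero_parityOp, hH]
    | succ k => rw [chainForm_succ_one, chainForm_succ_one]
  · rw [parityOp_wedge P (h.homogeneous_dual hB b), LinearMap.map_smulₛₗ, conj_koszul,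
      LinearMap.smul_apply]
    cases k with
    | zero => rw [chainForm_zero_wedge, chainForm_zero_wedge, smul_zero]
    | succ k =>
      rw [chainForm_succ_wedge, chainForm_succ_wedge, contract_parityOp, map_smul, hf k]

end Parity

/-! ### Complements in quotients and the main theorem -/

/-- Orthogonal complements with respect to a positive definite hermitian form. -/
theorem isCompl_of_form {Z : Type*} [AddCommGroup Z] [Module ℂ Z] [FiniteDimensional ℂ Z]
    (H : Z →ₛₗ[starRingEnd ℂ] Z →ₗ[ℂ] ℂ) (hsymm : ∀ v w, H w v = conj (H v w))
    (hnonneg : ∀ v, 0 ≤ (H v v).re) (hdef : ∀ v, (H v v).re = 0 → v = 0)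
    (U U' : Submodule ℂ Z) (hU' : ∀ v, v ∈ U' ↔ ∀ u ∈ U, H u v = 0) : IsCompl U U' := by
  let core : InnerProductSpace.Core ℂ Z :=
    { inner := fun v w => H v w
      conj_inner_symm := fun v w => (hsymm w v).symm
      re_inner_nonneg := hnonneg
      add_left := fun x y z => by simp
      smul_left := fun x y r => by simp
      definite := fun v hv => hdef v (by
        have : H v v = 0 := hv
        rw [this, Complex.zero_re]) }
  let _ : NormedAddCommGroup Z := core.toNormedAddCommGroup
  let _ : InnerProductSpace ℂ Z := InnerProductSpace.ofCore core.toCore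
  have e : U' = Uᗮ := by
    ext v
    rw [hU', Submodule.mem_orthogonal]
    rfl
  rw [e]
  exact U.isCompl_orthogonal

/-- With this, complements in homology come from complements of preimages among the cycles, and no
hermitian form on the quotient is needed. -/
theorem isCompl_map_mkQ {Z : Type*} [AddCommGroup Z] [Module ℂ Z] (p : Submodule ℂ Z)
    (U : Submodule ℂ (Z ⧸ p)) (U' : Submodule ℂ Z) (h : IsCompl (U.comap p.mkQ) U') :
    IsCompl U (U'.map p.mkQ) := by
  constructor
  · rw [Submodule.disjoint_def]
    rintro _ hx ⟨v, hv, rfl⟩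
    rw [Submodule.disjoint_def.1 h.disjoint v hx hv, map_zero]
  · rw [codisjoint_iff, ← Submodule.map_comap_eq_of_surjective p.mkQ_surjective U,
      ← Submodule.map_sup, h.codisjoint.eq_top, Submodule.map_top, Submodule.range_mkQ]

end KostantSuper

end

open KostantSuper in
theorem mainTheorem10 {g : Type*} [AddCommGroup g] [Module ℂ g] [KostantSuper.LieSuperalgebra g]
    (hg : KostantSuper.IsBasicClassical g) (hI : KostantSuper.IsTypeI g)
    (P : KostantSuper.Parabolic g)
    (W : Type*) [AddCommGroup W] [Module ℂ W] [KostantSuper.SuperSpace W]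
    [KostantSuper.LieSupermodule g W] [FiniteDimensional ℂ W]
    (hW : KostantSuper.IsIrreducible g W)
    (dag : g →ₛₗ[starRingEnd ℂ] g) (hdag : KostantSuper.IsAdjointOperation dag)
    (hstar : KostantSuper.IsStarRepresentation W dag)
    (B : g →ₗ[ℂ] g →ₗ[ℂ] ℂ) (hB : KostantSuper.IsKillingForm B)
    {ι : Type*} [Fintype ι] [DecidableEq ι] (par : ι → ZMod 2)
    (ξ : Module.Basis ι ℂ P.n) (ξd : Module.Basis ι ℂ P.nbar)
    (hξ : KostantSuper.IsDualBasis P B par ξ ξd)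
    (hdual : ∀ a, dag (ξ a : g) = KostantSuper.koszul (par a) (par a) • (ξd a : g)) :
    KostantSuper.DisjointOperators (KostantSuper.coboundary W hB hξ) (KostantSuper.boundary P W) ∧
      ∀ k : ℕ, KostantSuper.HomologyCompletelyReducible P W k := by
  have := hg.finiteDimensional
  obtain ⟨H, hsymm, hpos, hadj, htwist⟩ := hstar.exists_form hdag
  have hbd := chainForm_boundary hg.simple hB hξ hdag hdual hadj
  have hact := chainForm_act hg.simple hB hξ hdag hdual hadj
  have hpar := chainForm_parityOp hB hξ htwist
  have hdef : ∀ f, (∀ k, chainForm hB hξ H k f f = 0) → f = 0 := fun f =>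
    eq_zero_of_forall_chainForm_self hB hξ H hsymm hpos
  refine ⟨⟨fun f hf => hdef _ fun k => ?_, fun f hf => hdef _ fun k => ?_⟩, fun k U hUp hUA => ?_⟩
  -- This is ⟨δ^*f, δ^*f⟩ = -⟨f, δδ^*f⟩ in each degree.
  · rw [hbd, hf, map_zero, neg_zero]
  -- The adjunction relates ⟨δf, δf⟩ in degree k + 1 to ⟨δ^*δf, f⟩ in degree k; degree 0 is
  -- separate, where δf has no component.
  · cases k with
    | zero => rw [chainForm_zero, degZero_coboundary, map_zero]
    | succ k =>
      have := hbd k (coboundary W hB hξ f) f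
      rw [hf, map_zero, LinearMap.zero_apply] at this
      exact neg_eq_zero.1 this.symm
  · let p := (boundaries P W k).submoduleOf (cycles P W k)
    have : FiniteDimensional ℂ (cycles P W k) :=
      Submodule.finiteDimensional_of_le (inf_le_right : cycles P W k ≤ chains P.nbar W k)
    let K : cycles P W k →ₛₗ[starRingEnd ℂ] cycles P W k →ₗ[ℂ] ℂ :=
      ((chainForm hB hξ H k).comp (cycles P W k).subtype).compl₂ (cycles P W k).subtype
    have hK : ∀ u v, K u v = chainForm hB hξ H k u v := fun u v => rfl
    -- The orthogonal complement, within the k-cycles, of the preimage of `U`.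
    let U' : Submodule ℂ (cycles P W k) :=
      { carrier := {v | ∀ u ∈ U.comap p.mkQ, K u v = 0}
        zero_mem' := fun u _ => map_zero _
        add_mem' := fun hv hw u hu => by rw [map_add, hv u hu, hw u hu, add_zero]
        smul_mem' := fun c v hv u hu => by rw [map_smul, hv u hu, smul_zero] }
    refine ⟨U'.map p.mkQ, ?_, ?_, isCompl_map_mkQ p U U' (isCompl_of_form K
      (fun v w => chainForm_symm hB hξ hsymm k _ _)
      (fun v => chainForm_self_nonneg hB hξ hpos k _)
      (fun v hv => Subtype.ext (eq_zero_of_chainForm_self hB hξ hpos v.2.2 hv)) _ _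
      fun v => Iff.rfl)⟩
    · rintro _ ⟨v, hv, rfl⟩
      refine ⟨⟨parityOp P W v, LinearMap.mem_ker.2 ?_, parityOp_mem_chains P k v.2.2⟩,
        fun u hu => ?_, rfl⟩
      · rw [← parityOp_boundary, LinearMap.mem_ker.1 v.2.1, map_zero]
      · have hu' := hUp _ hu
        rw [hK, ← hpar]
        exact hv ⟨parityOp P W u, LinearMap.mem_ker.2
          (by rw [← parityOp_boundary, LinearMap.mem_ker.1 u.2.1, map_zero]),
          parityOp_mem_chains P k u.2.2⟩ hu'
    · rintro A _ ⟨v, hv, rfl⟩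
      refine ⟨⟨act P W (A : g) v, LinearMap.mem_ker.2 ?_, act_mem_chains P _ k v.2.2⟩,
        fun u hu => ?_, rfl⟩
      · rw [boundary_act_levi, LinearMap.mem_ker.1 v.2.1, map_zero]
      -- For u in the preimage of `U`, ⟨u, A[v]⟩ = ⟨A^†[u], v⟩ = 0, because A^† lies in l and hence
      -- preserves that preimage.
      · let A' : P.levi := ⟨dag A, hξ.dag_levi hg.simple hB hdag hdual A.2⟩
        have hu' := hUA A' _ hu
        have e := hact (A' : g) k u v
        rw [show dag (A' : g) = A from hdag.involutive _] at e
        refine e.symm.trans ?_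
        exact hv ⟨act P W (A' : g) u, LinearMap.mem_ker.2
          (by rw [boundary_act_levi, LinearMap.mem_ker.1 u.2.1, map_zero]),
          act_mem_chains P _ k u.2.2⟩ hu'
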